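/- Let $A$ be a commutative Banach algebra (complex, with unit $1_A$). A Banach $A$-module is a complex Banach space $X$ with an $A$-module structure such that $(c1_A)x=cx$ and $\|ax\|\le\|a\|\|x\|$. A map $f$ from an open set $U$ of a Banach $A$-module to a Banach $A$-module is $A$-differentiable if it is Fréchet differentiable on $U$ and each derivative $(Df)_p$, $p\in U$, is $A$-linear. An $A$-manifold is a Hausdorff space $M$ with a system $S$ of coordinate neighborhoods: each $\varphi\in S$ is a homeomorphism from an open set $U_\varphi\subset M$ onto an open set of a Banach $A$-module $X_\varphi$, the $U_\varphi$ cover $M$, and all coordinate transformations $\psi\circ\varphi^{-1}:\varphi(U_\varphi\cap U_\psi)\to\psi(U_\varphi\cap U_\psi)$ are $A$-differentiable. A continuous map between (open subsets of) $A$-manifolds is $A$-holomorphic if it is $A$-differentiable in all coordinates. An $A$-holomorphic vector bundle over an $A$-manifold $M$ is an $A$-manifold $E$ with an $A$-holomorphic surjection $\pi:E\to M$ and a system of local trivializations, that is, open sets $U_\lambda$ covering $M$, Banach $A$-modules $X_\lambda$ and maps $\varphi_\lambda:\pi^{-1}(U_\lambda)\to X_\lambda$, such that each $(\varphi_\lambda,\pi):\pi^{-1}(U_\lambda)\to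 X_\lambda\times U_\lambda$ is $A$-biholomorphic and, for all $\lambda,\mu$ and $p\in U_\lambda\cap U_\mu$, the map $\varphi_\mu|_{\pi^{-1}(p)}\circ(\varphi_\lambda|_{\pi^{-1}(p)})^{-1}:X_\lambda\to X_\mu$ is $A$-linear. For a topological $A$-module $X$ let $A_A^k(X)$ be the $A$-module of continuous antisymmetric $A$-multilinear forms $X^k\to A$; if $X$ is a Banach $A$-module, so is $A_A^k(X)$ with the operator norm. Let $M$ be an $A$-manifold with the system $S$ of coordinate neighborhoods and let $k\ge 0$. For $p\in M$ the tangent space $T_pM$ is the quotient of the disjoint union of the $X_\varphi$ ($\varphi\in S$, $p\in U_\varphi$) by the relation that identifies $v\in X_\varphi$ with $(D(\psi\circ\varphi^{-1}))_{\varphi(p)}(v)\in X_\psi$, with the structure of a topological $A$-module for which all the induced bijections $\varphi_T|_p:T_pM\to X_\varphi$ are isomorphisms of topological $A$-modules. Let $(\wedge^kT^*)(M)=\bigsqcup_{p\in M}A_A^k(T_pM)$ with the projection $\pi$ to $M$, and for $\varphi\in S$ let $\varphi_{\wedge^kT^*}:\pi^{-1}(U_\varphi)\to A_A^k(X_\varphi)$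 be given by $(\varphi_{\wedge^kT^*}(f))(x_1,\dots,x_k)=f((\varphi_T|_p)^{-1}x_1,\dots,(\varphi_T|_p)^{-1}x_k)$ for $f\in A_A^k(T_pM)$. Then: 1. The sets $(\varphi_{\wedge^kT^*},\pi)^{-1}(G\times V)$, with $\varphi\in S$, $G\subset A_A^k(X_\varphi)$ open and $V\subset U_\varphi$ open, are an open base of a topology on $(\wedge^kT^*)(M)$, and this topology is Hausdorff. 2. With this topology $(\wedge^kT^*)(M)$ is an $A$-manifold with $\{(\varphi_{\wedge^kT^*},\varphi\circ\pi)\}_{\varphi\in S}$ as the system of coordinate neighborhoods. 3. This $A$-manifold is an $A$-holomorphic vector bundle over $M$ with projection $\pi$ and with $\{(\varphi_{\wedge^kT^*},\pi)\}_{\varphi\in S}$ as the system of local trivializations. 4. For $U\subset M$ open let $O_M(U)$ be the set of $A$-valued $A$-holomorphic maps on $U$ and $\Omega^k_M(U)$ the set of $A$-holomorphic sections of $(\wedge^kT^*)(M)$ on $U$. With the pointwise operations and the restriction of maps, $O_M$ is a sheaf of $A$-algebras and $\Omega^k_M$ is a sheaf of $O_M$-modules. -/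

import Mathlib

open Set Topology TopologicalSpace

universe u v w v₁ w₁ v₂ w₂

noncomputable section

/-! ### Banach modules over a commutative Banach algebra -/

/-- A Banach module over the (complex, unital) commutative Banach algebra `A`: a complex Banach
space with an `A`-module structure such that `(c • 1) • x = c • x` and `‖a • x‖ ≤ ‖a‖ * ‖x‖`. -/
structure BanachMod (A : Type u) [NormedCommRing A] [NormedAlgebra ℂ A] where
  carrier : Type w
  [normed : NormedAddCommGroup carrier]
  [space : NormedSpace ℂ carrier]
  [module : Module A carrier]
  [tower : IsScalarTower ℂ A carrier]
  [bounded : IsBoundedSMul A carrier]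
  [complete : CompleteSpace carrier]

namespace BanachMod

variable {A : Type u} [NormedCommRing A] [NormedAlgebra ℂ A]

instance : CoeSort (BanachMod.{u, w} A) (Type w) := ⟨BanachMod.carrier⟩

attribute [instance] BanachMod.normed BanachMod.space BanachMod.module BanachMod.tower
  BanachMod.bounded BanachMod.complete

/-- The algebra `A` as a Banach module over itself. -/
abbrev self (A : Type u) [NormedCommRing A] [NormedAlgebra ℂ A] [CompleteSpace A] :
    BanachMod.{u, u} A where
  carrier := A

/-- The product of two Banach modules, with the maximum norm. -/
abbrev prod (X : BanachMod.{u, w₁} A) (Y : BanachMod.{u, w₂} A) :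
    BanachMod.{u, max w₁ w₂} A where
  carrier := X × Y

end BanachMod

/-! ### Continuous antisymmetric forms -/

section Forms

variable (A : Type u) [NormedCommRing A]

/-- `L_A(X, …, X; A)` is the Mathlib type of continuous `A`-multilinear maps; this is its
`A`-submodule of antisymmetric forms. -/
def altSubmodule (X : Type w) [AddCommGroup X] [Module A X] [TopologicalSpace X] (k : ℕ) :
    Submodule A (ContinuousMultilinearMap A (fun _ : Fin k => X) A) where
  carrier := {f | ∀ (σ : Equiv.Perm (Fin k)) (x : Fin k → X),
    f (fun i => x (σ i)) = Equiv.Perm.sign σ • f x}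
  zero_mem' := by
    intro σ x
    simp
  add_mem' := by
    intro f g hf hg σ x
    simp [hf σ x, hg σ x]
  smul_mem' := by
    intro a f hf σ x
    simp only [smul_apply, hf σ x]
    rw [smul_comm]

/-- The `A`-module `A_A^k(X)` of continuous antisymmetric `(A, k)`-linear forms of `X`. -/
def AltForm (X : Type w) [AddCommGroup X] [Module A X] [TopologicalSpace X] (k : ℕ) :
    Type (max u w) :=
  altSubmodule A X k

namespace AltForm

variable {A}
variable {X : Type w} [AddCommGroup X] [Module A X] [TopologicalSpace X] {k : ℕ}

instance : AddCommGroup (AltForm A X k) := inferInstanceAs (AddCommGroup (altSubmodule A X k))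

instance : Module A (AltForm A X k) := inferInstanceAs (Module A (altSubmodule A X k))

/-- The underlying continuous multilinear map. -/
def toMultilinear (f : AltForm A X k) : ContinuousMultilinearMap A (fun _ : Fin k => X) A := f.1

instance : CoeFun (AltForm A X k) (fun _ => (Fin k → X) → A) := ⟨fun f => f.toMultilinear⟩

/-- The pull back `F^* f` of a form `f` along a continuous `A`-linear map `F`. -/
def pullback {Y : Type w₁} [AddCommGroup Y] [Module A Y] [TopologicalSpace Y]
    (F : X →L[A] Y) (f : AltForm A Y k) : AltForm A X k :=
  ⟨f.toMultilinear.compContinuousLinearMap (fun _ => F), fun σ x => f.2 σ (fun i => F (x i))⟩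

end AltForm

end Forms

namespace AltForm

variable {A : Type u} [NormedCommRing A] [NormedAlgebra ℂ A]

/-- A form on a Banach module, seen as a continuous `ℂ`-multilinear map. -/
def toComplex (X : BanachMod.{u, w} A) (k : ℕ) :
    AltForm A X k →+ ContinuousMultilinearMap ℂ (fun _ : Fin k => (X : Type w)) A where
  toFun f := f.toMultilinear.restrictScalars ℂ
  map_zero' := rfl
  map_add' _ _ := rfl

theorem toComplex_injective (X : BanachMod.{u, w} A) (k : ℕ) :
    Function.Injective (toComplex X k) := by
  intro f g h
  apply Subtype.ext
  ext x
  exact congrArg (fun F : ContinuousMultilinearMap ℂ (fun _ : Fin k => (X : Type w)) A => F x) h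

/-- The norm of a form on a Banach module: its operator norm as a multilinear map. -/
instance (X : BanachMod.{u, w} A) (k : ℕ) : NormedAddCommGroup (AltForm A X k) :=
  NormedAddCommGroup.induced _ _ (toComplex X k) (toComplex_injective X k)

theorem norm_def (X : BanachMod.{u, w} A) (k : ℕ) (f : AltForm A X k) :
    ‖f‖ = ‖toComplex X k f‖ := rfl

instance (X : BanachMod.{u, w} A) (k : ℕ) : IsBoundedSMul A (AltForm A X k) :=
  IsBoundedSMul.of_norm_smul_le (α := A) (β := AltForm A X k) fun a f => by
    rw [norm_def, norm_def]
    refine ContinuousMultilinearMap.opNorm_le_bound (by positivity) fun x => ?_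
    calc ‖a * toComplex X k f x‖ ≤ ‖a‖ * ‖toComplex X k f x‖ := norm_mul_le _ _
      _ ≤ ‖a‖ * (‖toComplex X k f‖ * ∏ i, ‖x i‖) := by
          gcongr
          exact (toComplex X k f).le_opNorm x
      _ = _ := by ring

instance (X : BanachMod.{u, w} A) (k : ℕ) : Module ℂ (AltForm A X k) :=
  Module.compHom _ (algebraMap ℂ A)

instance (X : BanachMod.{u, w} A) (k : ℕ) : IsScalarTower ℂ A (AltForm A X k) :=
  ⟨fun c a f => by
    change (c • a) • f = algebraMap ℂ A c • (a • f)
    rw [smul_smul, Algebra.smul_def]⟩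

instance (X : BanachMod.{u, w} A) (k : ℕ) : NormedSpace ℂ (AltForm A X k) where
  norm_smul_le c f := by
    have h : toComplex X k (c • f) = c • toComplex X k f := by
      ext x
      change algebraMap ℂ A c * toComplex X k f x = c • toComplex X k f x
      rw [Algebra.smul_def]
    rw [norm_def, norm_def, h]
    exact norm_smul_le c (toComplex X k f)

theorem toComplex_range (X : BanachMod.{u, w} A) (k : ℕ) :
    range (toComplex X k) =
      {F | (∀ (m : Fin k → X) (i : Fin k) (a : A) (x : X),
          F (Function.update m i (a • x)) = a * F (Function.update m i x)) ∧
        ∀ (σ : Equiv.Perm (Fin k)) (x : Fin k → X),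
          F (fun i => x (σ i)) = Equiv.Perm.sign σ • F x} := by
  ext F
  constructor
  · rintro ⟨f, rfl⟩
    exact ⟨fun m i a x => f.toMultilinear.map_update_smul m i a x, f.2⟩
  · rintro ⟨h₁, h₂⟩
    refine ⟨⟨{ toFun := F
               map_update_add' := fun {inst} m i x y => ?_
               map_update_smul' := fun {inst} m i a x => ?_
               cont := F.cont }, h₂⟩, ?_⟩
    · exact F.map_update_add' m i x y
    · have : inst = instDecidableEqFin k := Subsingleton.elim _ _
      subst this
      exact h₁ m i a x
    · ext x
      rfl

instance (X : BanachMod.{u, w} A) (k : ℕ) [CompleteSpace A] : CompleteSpace (AltForm A X k) := by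
  have hu : IsUniformInducing (toComplex X k) := ⟨rfl⟩
  rw [completeSpace_iff_isComplete_range hu, toComplex_range]
  apply IsClosed.isComplete
  have he : ∀ x : Fin k → X, Continuous
      fun F : ContinuousMultilinearMap ℂ (fun _ : Fin k => (X : Type w)) A => F x :=
    fun x => continuous_eval_const x
  simp only [ofPred_and, ofPred_forall]
  refine IsClosed.inter ?_ ?_
  · refine isClosed_iInter fun m => isClosed_iInter fun i => isClosed_iInter fun a =>
      isClosed_iInter fun x => ?_
    exact isClosed_eq (he _) (continuous_const.mul (he _))
  · refine isClosed_iInter fun σ => isClosed_iInter fun x => ?_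
    exact isClosed_eq (he _) ((he _).const_smul _)

/-- `A_A^k(X)` as a Banach module, for a Banach module `X`. -/
abbrev banach [CompleteSpace A] (X : BanachMod.{u, w} A) (k : ℕ) : BanachMod.{u, max u w} A where
  carrier := AltForm A X k

end AltForm

/-! ### Manifolds and holomorphic maps -/

section Manifolds

variable {A : Type u} [NormedCommRing A] [NormedAlgebra ℂ A]

/-- `f` is `A`-differentiable on (the open set) `U`: it is Fréchet differentiable there and its
derivatives are `A`-linear. -/
def ADifferentiableOn {X : BanachMod.{u, w₁} A} {Y : BanachMod.{u, w₂} A} (f : X → Y)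
    (U : Set X) : Prop :=
  ∀ z ∈ U, DifferentiableAt ℂ f z ∧
    ∀ (a : A) (h : X), fderiv ℂ f z (a • h) = a • fderiv ℂ f z h

variable (A) in
/-- The data of a coordinate neighbourhood: a bijection from a subset of `M` to a subset of a
Banach module. -/
structure AChart (M : Type v) where
  Model : BanachMod.{u, w} A
  toPartialEquiv : PartialEquiv M Model

namespace AChart

variable {M : Type v} (φ : AChart.{u, v, w} A M)

instance : CoeFun (AChart.{u, v, w} A M) (fun φ => M → φ.Model) := ⟨fun φ => φ.toPartialEquiv⟩

/-- The domain `U_φ`. -/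
abbrev source : Set M := φ.toPartialEquiv.source

/-- The image `φ(U_φ)`. -/
abbrev target : Set φ.Model := φ.toPartialEquiv.target

/-- The inverse map. -/
abbrev symm : φ.Model → M := φ.toPartialEquiv.symm

/-- `φ` is a homeomorphism from an open set of `M` to an open set of its Banach module. -/
structure IsOpenHomeo [TopologicalSpace M] : Prop where
  isOpen_source : IsOpen φ.source
  isOpen_target : IsOpen φ.target
  continuousOn : ContinuousOn φ φ.source
  continuousOn_symm : ContinuousOn φ.symm φ.target

/-- The product of two charts. -/
abbrev prod {N : Type v₂} (ψ : AChart.{u, v₂, w₂} A N) : AChart.{u, max v v₂, max w w₂} A (M × N) where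
  Model := φ.Model.prod ψ.Model
  toPartialEquiv := φ.toPartialEquiv.prod ψ.toPartialEquiv

end AChart

/-- The identity of a Banach module, as a chart. -/
abbrev BanachMod.idChart (X : BanachMod.{u, w} A) : AChart.{u, w, w} A X where
  Model := X
  toPartialEquiv := PartialEquiv.refl X

/-- The topological space `M` is an `A`-manifold with the system `S` of coordinate
neighbourhoods. -/
structure IsAManifold {M : Type v} [TopologicalSpace M] {ι : Type v₁}
    (S : ι → AChart.{u, v, w} A M) : Prop where
  t2 : T2Space M
  homeo : ∀ i, (S i).IsOpenHomeo
  cover : ∀ p, ∃ i, p ∈ (S i).source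
  compat : ∀ i j, ADifferentiableOn (S j ∘ (S i).symm) (S i '' ((S i).source ∩ (S j).source))

/-- The map `f : U → M₂`, where `U` is an (open) subset of `M₁`, is `A`-holomorphic with respect to
the systems of coordinate neighbourhoods `S₁` and `S₂`: it is continuous, and in all coordinates
`φ₁ = S₁ i` and `φ₂ = S₂ j` the map `φ₂ ∘ f ∘ φ₁⁻¹ : φ₁(U₁ ∩ f⁻¹(U₂)) → X₂` (which is the unique `g`
below, restricted to that set) is `A`-differentiable. -/
def AHolomorphic {M₁ : Type v₁} [TopologicalSpace M₁] {ι₁ : Type*}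
    (S₁ : ι₁ → AChart.{u, v₁, w₁} A M₁)
    {M₂ : Type v₂} [TopologicalSpace M₂] {ι₂ : Type*} (S₂ : ι₂ → AChart.{u, v₂, w₂} A M₂)
    {U : Set M₁} (f : U → M₂) : Prop :=
  Continuous f ∧ ∀ i j, ∃ g : (S₁ i).Model → (S₂ j).Model,
    (∀ p : U, (p : M₁) ∈ (S₁ i).source → f p ∈ (S₂ j).source → g (S₁ i p) = S₂ j (f p)) ∧
    ADifferentiableOn g {z | ∃ p : U, (p : M₁) ∈ (S₁ i).source ∧ f p ∈ (S₂ j).source ∧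
      S₁ i p = z}

/-- The bijection `e` between (open) subsets of two `A`-manifolds is `A`-biholomorphic. -/
def ABiholomorphic {M₁ : Type v₁} [TopologicalSpace M₁] {ι₁ : Type*}
    (S₁ : ι₁ → AChart.{u, v₁, w₁} A M₁)
    {M₂ : Type v₂} [TopologicalSpace M₂] {ι₂ : Type*} (S₂ : ι₂ → AChart.{u, v₂, w₂} A M₂)
    {U₁ : Set M₁} {U₂ : Set M₂} (e : U₁ ≃ U₂) : Prop :=
  AHolomorphic S₁ S₂ (fun x => (e x : M₂)) ∧ AHolomorphic S₂ S₁ (fun y => (e.symm y : M₁))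

variable (A) in
/-- The data of a local trivialization of `E` over `M`: the set `U_λ`, the Banach module `X_λ` and
the map `φ_λ` (of which only the values on the preimage of `U_λ` matter). -/
structure LocalTriv (E : Type v₁) (M : Type v₂) where
  base : Set M
  Model : BanachMod.{u, w} A
  toFun : E → Model

/-- `π : E → M` is an `A`-holomorphic vector bundle with the local trivializations `T`, where `E`
and `M` carry the systems of coordinate neighbourhoods `SE` and `SM`. -/
structure IsAHolomorphicVectorBundle {E : Type v₁} [TopologicalSpace E] {ιE : Type*}
    (SE : ιE → AChart.{u, v₁, w₁} A E) {M : Type v₂} [TopologicalSpace M] {ιM : Type*}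
    (SM : ιM → AChart.{u, v₂, w₂} A M) (π : E → M) {Λ : Type*}
    (T : Λ → LocalTriv.{u, w, v₁, v₂} A E M) : Prop where
  total : IsAManifold SE
  base : IsAManifold SM
  proj_holomorphic : AHolomorphic SE SM (U := univ) (fun x => π x)
  proj_surjective : Function.Surjective π
  isOpen_base : ∀ l, IsOpen (T l).base
  cover : ⋃ l, (T l).base = univ
  biholomorphic : ∀ l, ∃ e : (π ⁻¹' (T l).base) ≃ ((univ ×ˢ (T l).base : Set ((T l).Model × M))),
    (∀ x, (e x : (T l).Model × M) = ((T l).toFun x, π x)) ∧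
    ABiholomorphic SE (fun i => (T l).Model.idChart.prod (SM i)) e
  linear : ∀ l m, ∀ p ∈ (T l).base ∩ (T m).base, ∃ L : (T l).Model →ₗ[A] (T m).Model,
    ∀ x, π x = p → (T m).toFun x = L ((T l).toFun x)

end Manifolds

/-! ### The tangent space -/

section Tangent

variable {A : Type u} [NormedCommRing A] [NormedAlgebra ℂ A]
  {M : Type v} [TopologicalSpace M] {ι : Type v₁} {S : ι → AChart.{u, v, w} A M}

/-- The derivative `(D(φⱼ ∘ φᵢ⁻¹))_{φᵢ(p)}`. -/
def transD (S : ι → AChart.{u, v, w} A M) (p : M) (i j : ι) : (S i).Model →L[ℂ] (S j).Model :=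
  fderiv ℂ (S j ∘ (S i).symm) (S i p)

theorem transD_self (hS : IsAManifold S) {p : M} {i : ι} (hi : p ∈ (S i).source) :
    transD S p i i = ContinuousLinearMap.id ℂ _ := by
  have h : (S i ∘ (S i).symm) =ᶠ[𝓝 (S i p)] id := by
    filter_upwards [(hS.homeo i).isOpen_target.mem_nhds ((S i).toPartialEquiv.map_source hi)]
      with z hz
    exact (S i).toPartialEquiv.right_inv hz
  unfold transD
  rw [h.fderiv_eq, fderiv_id]

theorem transD_comp (hS : IsAManifold S) {p : M} {i j l : ι} (hi : p ∈ (S i).source)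
    (hj : p ∈ (S j).source) (hl : p ∈ (S l).source) (x : (S i).Model) :
    transD S p j l (transD S p i j x) = transD S p i l x := by
  have hp : (S i).symm (S i p) = p := (S i).toPartialEquiv.left_inv hi
  have ht : S i p ∈ (S i).target := (S i).toPartialEquiv.map_source hi
  have hc : ContinuousAt (S i).symm (S i p) :=
    (hS.homeo i).continuousOn_symm.continuousAt ((hS.homeo i).isOpen_target.mem_nhds ht)
  have h : (S l ∘ (S i).symm) =ᶠ[𝓝 (S i p)] (S l ∘ (S j).symm) ∘ (S j ∘ (S i).symm) := by
    have hm : (S j).source ∈ 𝓝 ((S i).symm (S i p)) := by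
      rw [hp]
      exact (hS.homeo j).isOpen_source.mem_nhds hj
    filter_upwards [hc hm] with z hz
    have := (S j).toPartialEquiv.left_inv hz
    exact congrArg (S l) this.symm
  have hpt : (S j ∘ (S i).symm) (S i p) = S j p := congrArg (S j) hp
  have h₁ := (hS.compat i j (S i p) ⟨p, ⟨hi, hj⟩, rfl⟩).1
  have h₂ := (hS.compat j l (S j p) ⟨p, ⟨hj, hl⟩, rfl⟩).1
  rw [← hpt] at h₂
  have h₃ := fderiv_comp (S i p) h₂ h₁
  unfold transD
  rw [h.fderiv_eq, h₃, hpt]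
  rfl

/-- The equivalence relation on the (disjoint) union of the Banach modules of the charts at `p`
that identifies vectors corresponding to each other under the derivatives of the coordinate
transformations. -/
def tangentSetoid (hS : IsAManifold S) (p : M) :
    Setoid (Σ i : {i // p ∈ (S i).source}, (S i.1).Model) where
  r x y := y.2 = transD S p x.1 y.1 x.2
  iseqv :=
    { refl := fun x => by rw [transD_self hS x.1.2]; rfl
      symm := fun {x y} h => by
        rw [h, transD_comp hS x.1.2 y.1.2 x.1.2, transD_self hS x.1.2]
        rfl
      trans := fun {x y z} h₁ h₂ => by
        rw [h₂, h₁, transD_comp hS x.1.2 y.1.2 z.1.2] }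

/-- The tangent space `T_p(M)`. -/
def TangentSp (hS : IsAManifold S) (p : M) : Type (max v₁ w) := Quotient (tangentSetoid hS p)

namespace TangentSp

variable (hS : IsAManifold S) (p : M)

/-- The tangent space carries the quotient topology. -/
instance : TopologicalSpace (TangentSp hS p) :=
  inferInstanceAs (TopologicalSpace (Quotient (tangentSetoid hS p)))

variable {p}

/-- The bijection `φ_T|_p` of `T_p(M)` with the Banach module of the chart `φ` at `p`. -/
def coord {i : ι} (hi : p ∈ (S i).source) : TangentSp hS p ≃ (S i).Model where
  toFun := Quotient.lift (fun x => transD S p x.1 i x.2) fun x y (h : y.2 = _) => by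
    rw [h, transD_comp hS x.1.2 y.1.2 hi]
  invFun x := Quotient.mk _ ⟨⟨i, hi⟩, x⟩
  left_inv t := by
    induction t using Quotient.ind with
    | _ x =>
      refine Quotient.sound ?_
      change x.2 = transD S p i x.1 (transD S p x.1 i x.2)
      rw [transD_comp hS x.1.2 hi x.1.2, transD_self hS x.1.2]
      rfl
  right_inv x := by
    change transD S p i i x = x
    rw [transD_self hS hi]
    rfl

theorem coord_symm_coord {i j : ι} (hi : p ∈ (S i).source) (hj : p ∈ (S j).source)
    (x : (S i).Model) : coord hS hj ((coord hS hi).symm x) = transD S p i j x := rfl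

theorem transD_coord {i j : ι} (hi : p ∈ (S i).source) (hj : p ∈ (S j).source)
    (t : TangentSp hS p) : transD S p i j (coord hS hi t) = coord hS hj t := by
  rw [← coord_symm_coord hS hi hj, Equiv.symm_apply_apply]

variable (p) in
/-- A chosen chart at `p`, used only to define the algebraic operations. -/
def ix : ι := (hS.cover p).choose

theorem ix_mem : p ∈ (S (ix hS p)).source := (hS.cover p).choose_spec

/-- The operations of `T_p(M)` are transported from the Banach module of a chart at `p`; by
`coordL` below, the choice of the chart does not matter. -/
instance : AddCommGroup (TangentSp hS p) := (coord hS (ix_mem hS)).addCommGroup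

instance : Module A (TangentSp hS p) := (coord hS (ix_mem hS)).module A

theorem transD_smul (hS : IsAManifold S) {i j : ι} (hi : p ∈ (S i).source) (hj : p ∈ (S j).source) (a : A)
    (x : (S i).Model) : transD S p i j (a • x) = a • transD S p i j x :=
  (hS.compat i j (S i p) ⟨p, ⟨hi, hj⟩, rfl⟩).2 a x

/-- For each chart `φ` at `p`, the bijection `φ_T|_p` is an isomorphism of topological
`A`-modules. -/
def coordL {i : ι} (hi : p ∈ (S i).source) : TangentSp hS p ≃L[A] (S i).Model where
  toFun := coord hS hi
  invFun := (coord hS hi).symm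
  left_inv := (coord hS hi).left_inv
  right_inv := (coord hS hi).right_inv
  map_add' s t := by
    rw [← transD_coord hS (ix_mem hS) hi, ← transD_coord hS (ix_mem hS) hi s,
      ← transD_coord hS (ix_mem hS) hi t, ← map_add]
    exact congrArg _ (Equiv.apply_symm_apply _ _)
  map_smul' a t := by
    rw [← transD_coord hS (ix_mem hS) hi, ← transD_coord hS (ix_mem hS) hi t, RingHom.id_apply,
      ← transD_smul hS (ix_mem hS) hi]
    exact congrArg _ (Equiv.apply_symm_apply _ _)
  continuous_toFun :=
    continuous_quot_lift _ (continuous_sigma fun j => (transD S p j.1 i).continuous)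
  continuous_invFun :=
    (continuous_quotient_mk' (s := tangentSetoid hS p)).comp
      (continuous_sigmaMk (σ := fun j : {j // p ∈ (S j).source} => ((S j.1).Model : Type w))
        (i := ⟨i, hi⟩))

end TangentSp

end Tangent

/-! ### The cotangent exterior bundle -/

section Cotangent

variable {A : Type u} [NormedCommRing A] [NormedAlgebra ℂ A]
  {M : Type v} [TopologicalSpace M] {ι : Type v₁} {S : ι → AChart.{u, v, w} A M}

/-- The cotangent exterior space `A_A^k(T_p(M))`. -/
abbrev CotangentSp (hS : IsAManifold S) (k : ℕ) (p : M) : Type (max u v₁ w) :=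
  AltForm A (TangentSp hS p) k

/-- The cotangent exterior bundle: the disjoint union of the spaces `A_A^k(T_p(M))`. -/
structure CotangentBundle (hS : IsAManifold S) (k : ℕ) where
  proj : M
  form : CotangentSp hS k proj

namespace CotangentBundle

variable (hS : IsAManifold S) (k : ℕ)

open Classical in
/-- The map `φ_{∧^k T^*}` on the preimage of `U_φ` (and `0` elsewhere): it sends the form `f` at
`p` to the form `(x₁, …, x_k) ↦ f((φ_T|_p)⁻¹ x₁, …, (φ_T|_p)⁻¹ x_k)`. -/
def fiberCoord (i : ι) (ω : CotangentBundle hS k) : AltForm A (S i).Model k :=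
  if hi : ω.proj ∈ (S i).source then
    AltForm.pullback ((TangentSp.coordL hS hi).symm : (S i).Model →L[A] TangentSp hS ω.proj) ω.form
  else 0

open Classical in
/-- The form at `p ∈ U_φ` with a given value of `φ_{∧^k T^*}` (and `0` at the other points). -/
def ofFiberCoord (i : ι) (p : M) (h : AltForm A (S i).Model k) : CotangentBundle hS k :=
  ⟨p, if hi : p ∈ (S i).source then
    AltForm.pullback (TangentSp.coordL hS hi : TangentSp hS p →L[A] (S i).Model) h else 0⟩

theorem ofFiberCoord_fiberCoord (i : ι) (ω : CotangentBundle hS k) (hi : ω.proj ∈ (S i).source) :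
    ofFiberCoord hS k i ω.proj (fiberCoord hS k i ω) = ω := by
  obtain ⟨p, f⟩ := ω
  replace hi : p ∈ (S i).source := hi
  simp only [ofFiberCoord, fiberCoord, dif_pos hi]
  congr 1
  apply Subtype.ext
  ext x
  change f.toMultilinear (fun l => _) = f.toMultilinear x
  congr 1
  funext l
  exact (TangentSp.coordL hS hi).symm_apply_apply (x l)

theorem fiberCoord_ofFiberCoord (i : ι) (p : M) (hi : p ∈ (S i).source)
    (h : AltForm A (S i).Model k) : fiberCoord hS k i (ofFiberCoord hS k i p h) = h := by
  have h₁ : ofFiberCoord hS k i p h = ⟨p, AltForm.pullback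
      (TangentSp.coordL hS hi : TangentSp hS p →L[A] (S i).Model) h⟩ := by
    simp only [ofFiberCoord, dif_pos hi]
  rw [h₁]
  simp only [fiberCoord, dif_pos hi]
  apply Subtype.ext
  ext x
  change h.toMultilinear (fun l => _) = h.toMultilinear x
  congr 1
  funext l
  exact (TangentSp.coordL hS hi).apply_symm_apply (x l)

/-- The family of sets `(φ_{∧^k T^*}, π)⁻¹(G × V)`, for `φ` a chart, `G` an open set of
`A_A^k(X_φ)` and `V` an open subset of `U_φ`. -/
def openBase : Set (Set (CotangentBundle hS k)) :=
  {W | ∃ (i : ι) (G : Set (AltForm A (S i).Model k)) (V : Set M), IsOpen G ∧ IsOpen V ∧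
    V ⊆ (S i).source ∧ W = {ω | fiberCoord hS k i ω ∈ G ∧ ω.proj ∈ V}}

instance : TopologicalSpace (CotangentBundle hS k) := generateFrom (openBase hS k)

/-- The chart `(φ_{∧^k T^*}, φ ∘ π)` of the cotangent exterior bundle that is induced by the
chart `φ`. -/
abbrev chart [CompleteSpace A] (i : ι) :
    AChart.{u, max u v v₁ w, max u w} A (CotangentBundle hS k) where
  Model := (AltForm.banach (S i).Model k).prod (S i).Model
  toPartialEquiv :=
    { toFun := fun ω => (fiberCoord hS k i ω, S i ω.proj)
      invFun := fun z => ofFiberCoord hS k i ((S i).symm z.2) z.1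
      source := {ω | ω.proj ∈ (S i).source}
      target := {z | z.2 ∈ (S i).target}
      map_source' := fun ω hω => (S i).toPartialEquiv.map_source hω
      map_target' := fun z hz => (S i).toPartialEquiv.map_target hz
      left_inv' := fun ω hω => by
        have h : (S i).symm (S i ω.proj) = ω.proj := (S i).toPartialEquiv.left_inv hω
        change ofFiberCoord hS k i ((S i).symm (S i ω.proj)) (fiberCoord hS k i ω) = ω
        rw [h]
        exact ofFiberCoord_fiberCoord hS k i ω hω
      right_inv' := fun z hz =>
        Prod.ext (fiberCoord_ofFiberCoord hS k i _ ((S i).toPartialEquiv.map_target hz) z.1)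
          ((S i).toPartialEquiv.right_inv hz) }

/-- The local trivialization `(φ_{∧^k T^*}, π)` of the cotangent exterior bundle that is induced by
the chart `φ`. -/
abbrev localTriv [CompleteSpace A] (i : ι) :
    LocalTriv.{u, max u w, max u v v₁ w, v} A (CotangentBundle hS k) M where
  base := (S i).source
  Model := AltForm.banach (S i).Model k
  toFun := fiberCoord hS k i

end CotangentBundle

end Cotangent

/-! ### Sheaves of sections -/

section Sheaves

variable {M : Type v} [TopologicalSpace M]

/-- The sets `P U` of (dependent) functions on the open sets `U` form a sheaf under the restriction
of functions. -/
structure IsSheafOfSections {F : M → Type w} (P : ∀ U : Opens M, Set (∀ p : U, F p)) : Prop where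
  restrict : ∀ {U V : Opens M} (h : V ≤ U) (s : ∀ p : U, F p), s ∈ P U →
    (fun p : V => s ⟨p, h p.2⟩) ∈ P V
  glue : ∀ {κ : Type v} (U : κ → Opens M) (s : ∀ (a : κ) (p : U a), F p), (∀ a, s a ∈ P (U a)) →
    (∀ (a b : κ) (p : M) (ha : p ∈ U a) (hb : p ∈ U b), s a ⟨p, ha⟩ = s b ⟨p, hb⟩) →
    ∃! t : ∀ p : (⨆ a, U a : Opens M), F p, t ∈ P (⨆ a, U a) ∧
      ∀ (a : κ) (p : M) (ha : p ∈ U a), t ⟨p, le_iSup U a ha⟩ = s a ⟨p, ha⟩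

variable {A : Type u} [NormedCommRing A]

/-- Under the pointwise operations, the sets `O U` of `A`-valued functions on the open sets `U` form
a sheaf of `A`-algebras, and the sets `Ω U` of sections of the `A`-modules `F p` form a sheaf of
modules on it. -/
structure IsSheafOfModules (O : ∀ U : Opens M, Set (U → A)) {F : M → Type w}
    [∀ p, AddCommGroup (F p)] [∀ p, Module A (F p)] (Ω : ∀ U : Opens M, Set (∀ p : U, F p)) :
    Prop where
  ring_sheaf : IsSheafOfSections (F := fun _ => A) O
  const_mem : ∀ (U : Opens M) (c : A), (fun _ => c) ∈ O U
  ring_add : ∀ (U : Opens M) (f g : U → A), f ∈ O U → g ∈ O U → (fun p => f p + g p) ∈ O U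
  ring_mul : ∀ (U : Opens M) (f g : U → A), f ∈ O U → g ∈ O U → (fun p => f p * g p) ∈ O U
  sheaf : IsSheafOfSections Ω
  zero_mem : ∀ U : Opens M, (fun _ => 0) ∈ Ω U
  add_mem : ∀ (U : Opens M) (s t : ∀ p : U, F p), s ∈ Ω U → t ∈ Ω U → (fun p => s p + t p) ∈ Ω U
  smul_mem : ∀ (U : Opens M) (f : U → A) (s : ∀ p : U, F p), f ∈ O U → s ∈ Ω U →
    (fun p => f p • s p) ∈ Ω U

variable [NormedAlgebra ℂ A] [CompleteSpace A] {ι : Type v₁}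

/-- `O_M(U)`: the `A`-valued `A`-holomorphic maps on `U`. -/
def holomorphicFunctions (S : ι → AChart.{u, v, w} A M) (U : Opens M) : Set (U → A) :=
  {f | AHolomorphic S (fun _ : Unit => (BanachMod.self A).idChart) (U := (U : Set M)) f}

/-- `Ω^k_M(U)`: the `A`-holomorphic differential `k`-forms on `U`, that is, the `A`-holomorphic
sections on `U` of the cotangent exterior bundle. -/
def holomorphicForms {S : ι → AChart.{u, v, w} A M} (hS : IsAManifold S) (k : ℕ) (U : Opens M) :
    Set (∀ p : U, CotangentSp hS k (p : M)) :=
  {s | AHolomorphic S (CotangentBundle.chart hS k) (U := (U : Set M))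
    (fun p => (⟨p, s p⟩ : CotangentBundle hS k))}

end Sheaves

end

/-! The fibre coordinates of one form in charts `i` and `j` differ by pull back along the derivative
of a coordinate transformation. A chart change of the bundle therefore sends `(f, y)` to the pull
back of `f` along `D(φᵢ ∘ φⱼ⁻¹)` at the point of chart `j` that corresponds to `y`, paired with
`φⱼ(φᵢ⁻¹ y)`. Everything rests on this map being `A`-differentiable, although the coordinate
transformations are only assumed differentiable once.

Two facts make this work. First, over `ℂ` one derivative gives the next, in operator norm:
`DifferentiableOn.differentiableAt_fderiv` obtains this on Banach spaces from Cauchy estimates for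
first and second differences. Second, the second derivative is symmetric, so `A`-linearity in its
inner argument, inherited from the first derivative, passes to the direction of differentiation:
`D²f(av, w) = D²f(w, av) = a D²f(w, v) = a D²f(v, w)`. This is `ADifferentiableAt.fderiv_apply`. The
Leibniz rule for `ω(D·, …, D·)` then yields `AltForm.aDifferentiableAt_of_eventually_eq`, and from
it the change of charts `CotangentBundle.aDifferentiableAt_fiberCoord`.

The rest is formal. Continuity of the chart changes makes the given sets a base and the charts
homeomorphisms; Hausdorffness comes from the base for distinct feet and from a fibre otherwise. The
same differentiability gives the manifold and the bundle. Holomorphy of functions and forms is a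
condition on germs, checked in one chart at a time, which gives the sheaf axioms and closure under
the operations. -/

noncomputable section

/-! ### Differentiability of the derivative of a holomorphic map between Banach spaces -/

section HolomorphicDerivative

open Metric Filter

variable {E : Type*} [NormedAddCommGroup E] [NormedSpace ℂ E]
  {F : Type*} [NormedAddCommGroup F] [NormedSpace ℂ F]

/-- Cauchy's estimate in one variable, applied to `f` on each complex line through `z`. -/
theorem norm_fderiv_le_of_norm_le_on_ball {f : E → F} {z : E} {r C : ℝ} (hr : 0 < r)
    (hf : DifferentiableOn ℂ f (ball z r)) (hC : ∀ w ∈ ball z r, ‖f w‖ ≤ C) :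
    ‖fderiv ℂ f z‖ ≤ 2 * C / r := by
  have hC0 : 0 ≤ C := (norm_nonneg _).trans (hC z (mem_ball_self hr))
  refine ContinuousLinearMap.opNorm_le_bound _ (by positivity) fun v => ?_
  rcases eq_or_ne v 0 with rfl | hv
  · simp
  have hv' : 0 < ‖v‖ := norm_pos_iff.2 hv
  -- Half the radius keeps the closed disc inside the open ball; this is the source of the factor 2.
  set ρ : ℝ := r / 2 / ‖v‖ with hρ
  have hρ0 : 0 < ρ := by positivity
  have hline : ∀ t ∈ closedBall (0 : ℂ) ρ, z + t • v ∈ ball z r := by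
    intro t ht
    rw [mem_closedBall_zero_iff] at ht
    rw [mem_ball, dist_eq_norm, add_sub_cancel_left, norm_smul]
    calc ‖t‖ * ‖v‖ ≤ ρ * ‖v‖ := by gcongr
      _ = r / 2 := by rw [hρ]; field_simp
      _ < r := by linarith
  have hder : ∀ t : ℂ, HasDerivAt (fun t : ℂ => z + t • v) v t := fun t => by
    simpa using ((hasDerivAt_id t).smul_const v).const_add z
  have hd : DifferentiableOn ℂ (fun t : ℂ => f (z + t • v)) (closedBall 0 ρ) := by
    intro t ht
    have h₁ := (hf.differentiableAt (isOpen_ball.mem_nhds (hline t ht))).hasFDerivAt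
    exact (h₁.comp_hasDerivAt t (hder t)).differentiableAt.differentiableWithinAt
  have hdc : DiffContOnCl ℂ (fun t : ℂ => f (z + t • v)) (ball 0 ρ) :=
    DifferentiableOn.diffContOnCl (by rwa [closure_ball _ hρ0.ne'])
  have h := Complex.norm_deriv_le_of_forall_mem_sphere_norm_le hρ0 hdc
    fun t ht => hC _ (hline t (sphere_subset_closedBall ht))
  have h0 : z ∈ ball z r := mem_ball_self hr
  have h₁ : HasFDerivAt f (fderiv ℂ f z) (z + (0 : ℂ) • v) := by
    simpa using (hf.differentiableAt (isOpen_ball.mem_nhds h0)).hasFDerivAt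
  have h₂ : deriv (fun t : ℂ => f (z + t • v)) 0 = fderiv ℂ f z v :=
    (h₁.comp_hasDerivAt (0 : ℂ) (hder 0)).deriv
  rw [h₂] at h
  refine h.trans (le_of_eq ?_)
  rw [hρ]
  field_simp

/-- Each point of the ball of radius `3r/4` has a ball of radius `r/4` around it inside the domain,
so Cauchy bounds the derivative there by `2C/(r/4)`; the mean value inequality on this convex ball
finishes. The bound is linear in `‖h‖` and uniform in `w`, so it can be applied again to the
difference itself. -/
theorem norm_add_sub_le_of_norm_le_on_ball {f : E → F} {z : E} {r C : ℝ} (hr : 0 < r)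
    (hf : DifferentiableOn ℂ f (ball z r)) (hC : ∀ w ∈ ball z r, ‖f w‖ ≤ C) {h w : E}
    (hh : ‖h‖ < r / 4) (hw : w ∈ ball z (r / 2)) : ‖f (w + h) - f w‖ ≤ 8 * C / r * ‖h‖ := by
  rw [mem_ball, dist_eq_norm] at hw
  have hsub : ∀ x ∈ ball z (3 * r / 4), ball x (r / 4) ⊆ ball z r := fun x hx =>
    ball_subset_ball' (by rw [mem_ball] at hx; linarith)
  have hb : ∀ x ∈ ball z (3 * r / 4), ‖fderiv ℂ f x‖ ≤ 8 * C / r := fun x hx => by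
    refine (norm_fderiv_le_of_norm_le_on_ball (by positivity) (hf.mono (hsub x hx))
      fun y hy => hC y (hsub x hx hy)).trans (le_of_eq ?_)
    field_simp
    ring
  have hd : ∀ x ∈ ball z (3 * r / 4), DifferentiableAt ℂ f x := fun x hx =>
    hf.differentiableAt (isOpen_ball.mem_nhds (hsub x hx (mem_ball_self (by positivity))))
  have := (convex_ball z (3 * r / 4)).norm_image_sub_le_of_norm_fderiv_le (𝕜 := ℂ) hd hb
    (x := w) (y := w + h) (by rw [mem_ball, dist_eq_norm]; linarith) (by
      rw [mem_ball, dist_eq_norm, add_sub_right_comm]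
      exact (norm_add_le _ _).trans_lt (by linarith))
  simpa using this

/-- A locally bounded and approximately additive map is differentiable at the origin. -/
theorem exists_hasFDerivAt_of_approx_additive {E G : Type*} [NormedAddCommGroup E]
    [NormedSpace ℝ E] [NormedAddCommGroup G] [NormedSpace ℝ G] [CompleteSpace G] {q : E → G}
    {δ K : ℝ} (hδ : 0 < δ) (hq : ∀ h, ‖h‖ < δ → ‖q h‖ ≤ K * ‖h‖)
    (hadd : ∀ h k, ‖h‖ < δ → ‖k‖ < δ → ‖q (h + k) - q h - q k‖ ≤ K * ‖h‖ * ‖k‖) :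
    ∃ B : E →L[ℝ] G, HasFDerivAt q B 0 := by
  -- The derivative is built as the limit of these dyadic difference quotients, as in Hyers'
  -- argument for approximately additive maps.
  set a : ℕ → E → G := fun n h => (2 : ℝ) ^ n • q ((2 : ℝ)⁻¹ ^ n • h) with ha
  have hnorm : ∀ (n : ℕ) (h : E), ‖(2 : ℝ)⁻¹ ^ n • h‖ = 2⁻¹ ^ n * ‖h‖ := fun n h => by
    rw [norm_smul, norm_pow, norm_inv, Real.norm_two]
  have hsmall : ∀ h : E, ∀ᶠ n in atTop, ‖(2 : ℝ)⁻¹ ^ n • h‖ < δ := fun h => by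
    have h₁ : Tendsto (fun n : ℕ => (2 : ℝ)⁻¹ ^ n * ‖h‖) atTop (𝓝 (0 * ‖h‖)) :=
      (tendsto_pow_atTop_nhds_zero_of_lt_one (by norm_num) (by norm_num)).mul_const _
    rw [zero_mul] at h₁
    filter_upwards [h₁.eventually (gt_mem_nhds hδ)] with n hn
    rwa [hnorm]
  have hpow : ∀ n : ℕ, (2 : ℝ) ^ n * 2⁻¹ ^ n = 1 := fun n => by
    rw [← mul_pow, mul_inv_cancel₀ two_ne_zero, one_pow]
  -- With `k = 2⁻⁽ⁿ⁺¹⁾h` the increment is `2ⁿ (q(2k) - 2 q(k))`, which `hadd` bounds by `2ⁿ K ‖k‖²`.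
  -- The form `C / 2 / 2 ^ n` with `C = K‖h‖²/2` sums to `C`, the constant in `hBq`.
  have hstep : ∀ h : E, ‖h‖ < δ → ∀ n : ℕ,
      dist (a n h) (a (n + 1) h) ≤ K * ‖h‖ ^ 2 / 2 / 2 / 2 ^ n := by
    intro h hh n
    set k : E := (2 : ℝ)⁻¹ ^ (n + 1) • h with hk
    have hkn : ‖k‖ = 2⁻¹ ^ (n + 1) * ‖h‖ := hnorm _ _
    have hkδ : ‖k‖ < δ := by
      rw [hkn]
      refine lt_of_le_of_lt ?_ hh
      exact mul_le_of_le_one_left (norm_nonneg _) (pow_le_one₀ (by norm_num) (by norm_num))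
    have hkk : k + k = (2 : ℝ)⁻¹ ^ n • h := by
      rw [hk, ← add_smul, pow_succ]
      congr 1
      ring
    have h₁ : a n h - a (n + 1) h = (2 : ℝ) ^ n • (q (k + k) - q k - q k) := by
      have h₂ : a (n + 1) h = (2 : ℝ) ^ n • (q k + q k) := by
        simp only [ha]
        rw [← hk, pow_succ, mul_smul, two_smul]
      rw [h₂, sub_sub, smul_sub, hkk]
    rw [dist_eq_norm, h₁, norm_smul, norm_pow, Real.norm_two]
    calc (2 : ℝ) ^ n * ‖q (k + k) - q k - q k‖ ≤ 2 ^ n * (K * ‖k‖ * ‖k‖) := by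
          gcongr
          exact hadd k k hkδ hkδ
      _ = (2 ^ n * 2⁻¹ ^ n) * (2⁻¹ ^ n * (K * ‖h‖ ^ 2 / 2 / 2)) := by rw [hkn, pow_succ]; ring
      _ = _ := by rw [hpow, one_mul, inv_pow]; field_simp
  have hlim₀ : ∀ h : E, ‖h‖ < δ → ∃ l, Tendsto (a · h) atTop (𝓝 l) := fun h hh =>
    cauchySeq_tendsto_of_complete (cauchySeq_of_le_geometric_two (hstep h hh))
  -- For large `h`, shrink by `2⁻ᴺ` into the `δ`-ball; this only shifts the sequence by `N` and
  -- rescales it.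
  have hlim : ∀ h : E, ∃ l, Tendsto (a · h) atTop (𝓝 l) := by
    intro h
    obtain ⟨N, hN⟩ := (hsmall h).exists
    obtain ⟨l, hl⟩ := hlim₀ _ hN
    refine ⟨(2 : ℝ) ^ N • l, (tendsto_add_atTop_iff_nat N).1 ((hl.const_smul _).congr fun n => ?_)⟩
    simp only [ha, smul_smul, pow_add]
    rw [mul_comm]
  choose B hB using hlim
  have hBq : ∀ h : E, ‖h‖ < δ → ‖q h - B h‖ ≤ K / 2 * ‖h‖ ^ 2 := fun h hh => by
    have := dist_le_of_le_geometric_two_of_tendsto₀ (hstep h hh) (hB h)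
    rw [dist_eq_norm] at this
    simp only [ha, pow_zero, one_smul] at this
    linarith
  have hBadd : ∀ h k, B (h + k) = B h + B k := by
    intro h k
    have h₁ : Tendsto (fun n => a n (h + k) - a n h - a n k) atTop
        (𝓝 (B (h + k) - B h - B k)) := ((hB _).sub (hB _)).sub (hB _)
    have h₂ : Tendsto (fun n : ℕ => (2 : ℝ)⁻¹ ^ n * (K * ‖h‖ * ‖k‖)) atTop (𝓝 0) := by
      simpa using (tendsto_pow_atTop_nhds_zero_of_lt_one (r := (2 : ℝ)⁻¹) (by norm_num)
        (by norm_num)).mul_const (K * ‖h‖ * ‖k‖)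
    have h₃ : Tendsto (fun n => a n (h + k) - a n h - a n k) atTop (𝓝 0) := by
      refine squeeze_zero_norm' ?_ h₂
      filter_upwards [hsmall h, hsmall k] with n hn hn'
      have := hadd _ _ hn hn'
      simp only [ha, smul_add, ← smul_sub]
      rw [norm_smul, norm_pow, Real.norm_two]
      calc (2 : ℝ) ^ n * _ ≤ 2 ^ n * (K * ‖(2 : ℝ)⁻¹ ^ n • h‖ * ‖(2 : ℝ)⁻¹ ^ n • k‖) := by gcongr
        _ = (2 ^ n * 2⁻¹ ^ n) * (2⁻¹ ^ n * (K * ‖h‖ * ‖k‖)) := by rw [hnorm, hnorm]; ring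
        _ = _ := by rw [hpow, one_mul]
    have h₄ := tendsto_nhds_unique h₁ h₃
    rw [sub_sub, sub_eq_zero] at h₄
    exact h₄
  have hBnorm : ∀ h, ‖B h‖ ≤ K * ‖h‖ := by
    intro h
    refine le_of_tendsto (hB h).norm ?_
    filter_upwards [hsmall h] with n hn
    simp only [ha]
    rw [norm_smul, norm_pow, Real.norm_two]
    calc (2 : ℝ) ^ n * ‖q ((2 : ℝ)⁻¹ ^ n • h)‖ ≤ 2 ^ n * (K * ‖(2 : ℝ)⁻¹ ^ n • h‖) := by
          gcongr
          exact hq _ hn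
      _ = (2 ^ n * 2⁻¹ ^ n) * (K * ‖h‖) := by rw [hnorm]; ring
      _ = _ := by rw [hpow, one_mul]
  -- Additive and bounded, hence continuous, hence real linear.
  let B' : E →+ G := AddMonoidHom.mk' B hBadd
  have hcont : Continuous B' := AddMonoidHomClass.continuous_of_bound B' K hBnorm
  refine ⟨B'.toRealLinearMap hcont, ?_⟩
  have hO : HasFDerivAt (fun h => q h - B'.toRealLinearMap hcont h) (0 : E →L[ℝ] G) 0 := by
    refine Asymptotics.IsBigO.hasFDerivAt (n := 2) ?_ one_lt_two
    refine Asymptotics.IsBigO.of_bound (K / 2) ?_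
    filter_upwards [ball_mem_nhds (0 : E) hδ] with h hh
    rw [mem_ball_zero_iff] at hh
    simpa [B'] using hBq h hh
  refine ((hO.add (B'.toRealLinearMap hcont).hasFDerivAt).congr_fderiv (zero_add _)).congr_of_eventuallyEq
    (.of_forall fun h => ?_)
  simp

/-- The increment `q` of the derivative is the derivative of a first difference of `f`, and its
failure to be additive is the derivative of a second difference. Cauchy estimates bound these by
multiples of `‖h‖` and `‖h‖‖k‖`, so `q` has a real derivative at the origin; symmetry of the second
derivative makes it complex linear. -/
theorem DifferentiableOn.differentiableAt_fderiv [CompleteSpace F] {f : E → F} {U : Set E}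
    (hf : DifferentiableOn ℂ f U) (hU : IsOpen U) {z : E} (hz : z ∈ U) :
    DifferentiableAt ℂ (fderiv ℂ f) z := by
  obtain ⟨r, hr, hrU, C, hC⟩ : ∃ r > 0, ball z r ⊆ U ∧ ∃ C, ∀ w ∈ ball z r, ‖f w‖ ≤ C := by
    have h₁ : ∀ᶠ w in 𝓝 z, ‖f w‖ < ‖f z‖ + 1 :=
      (hf.differentiableAt (hU.mem_nhds hz)).continuousAt.norm.eventually
        (gt_mem_nhds (lt_add_one _))
    obtain ⟨r, hr, h⟩ := Metric.mem_nhds_iff.1 (h₁.and (hU.mem_nhds hz))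
    exact ⟨r, hr, fun w hw => (h hw).2, _, fun w hw => (h hw).1.le⟩
  have hfr : DifferentiableOn ℂ f (ball z r) := hf.mono hrU
  have hC0 : 0 ≤ C := (norm_nonneg _).trans (hC z (mem_ball_self hr))
  have hat : ∀ w ∈ ball z r, DifferentiableAt ℂ f w := fun w hw =>
    hfr.differentiableAt (isOpen_ball.mem_nhds hw)
  have hmem : ∀ w h : E, w ∈ ball z (r / 2) → ‖h‖ < r / 4 → w + h ∈ ball z (3 * r / 4) := by
    intro w h hw hh
    rw [mem_ball, dist_eq_norm] at hw ⊢
    rw [add_sub_right_comm]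
    exact (norm_add_le _ _).trans_lt (by linarith)
  have hshift : ∀ w h : E, w + h ∈ ball z r →
      HasFDerivAt (fun w => f (w + h)) (fderiv ℂ f (w + h)) w := fun w h hw =>
    ((hat _ hw).hasFDerivAt.comp w ((hasFDerivAt_id w).add_const h)).congr_fderiv
      (ContinuousLinearMap.comp_id _)
  set g : E → E → F := fun h w => f (w + h) - f w with hg
  have hg' : ∀ h w : E, ‖h‖ < r / 4 → w ∈ ball z (r / 2) →
      HasFDerivAt (g h) (fderiv ℂ f (w + h) - fderiv ℂ f w) w := fun h w hh hw =>
    (hshift w h (ball_subset_ball (by linarith) (hmem w h hw hh))).sub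
      (hat w (ball_subset_ball (by linarith) hw)).hasFDerivAt
  have hgd : ∀ h : E, ‖h‖ < r / 4 → DifferentiableOn ℂ (g h) (ball z (r / 2)) := fun h hh w hw =>
    (hg' h w hh hw).differentiableAt.differentiableWithinAt
  have hgb : ∀ h : E, ‖h‖ < r / 4 → ∀ w ∈ ball z (r / 2), ‖g h w‖ ≤ 8 * C / r * ‖h‖ :=
    fun h hh w hw => norm_add_sub_le_of_norm_le_on_ball hr hfr hC hh hw
  have hr2 : (0 : ℝ) < r / 2 := by positivity
  have hz2 : ∀ s : ℝ, 0 < s → z ∈ ball z s := fun s hs => mem_ball_self hs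
  set q : E → E →L[ℂ] F := fun h => fderiv ℂ f (z + h) - fderiv ℂ f z with hqdef
  have hq : ∀ h : E, ‖h‖ < r / 8 → ‖q h‖ ≤ 32 * C / r ^ 2 * ‖h‖ := by
    intro h hh
    have hh' : ‖h‖ < r / 4 := by linarith
    rw [hqdef]
    dsimp only
    rw [← (hg' h z hh' (hz2 _ hr2)).fderiv]
    refine (norm_fderiv_le_of_norm_le_on_ball hr2 (hgd h hh') (hgb h hh')).trans (le_of_eq ?_)
    field_simp
    ring
  have hadd : ∀ h k : E, ‖h‖ < r / 8 → ‖k‖ < r / 8 →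
      ‖q (h + k) - q h - q k‖ ≤ 1024 * C / r ^ 3 * ‖h‖ * ‖k‖ := by
    intro h k hh hk
    -- The difference estimate is now used for `g h` on the ball of radius `r/2`; its requirement
    -- `‖k‖ < (r/2)/4` is the reason for the threshold `r/8`.
    have hh' : ‖h‖ < r / 4 := by linarith
    have hr4 : (0 : ℝ) < r / 4 := by positivity
    have hmem' : ∀ w ∈ ball z (r / 4), w + k ∈ ball z (r / 2) := by
      intro w hw
      rw [mem_ball, dist_eq_norm] at hw ⊢
      rw [add_sub_right_comm]
      exact (norm_add_le _ _).trans_lt (by linarith)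
    have hG : ∀ w ∈ ball z (r / 4), HasFDerivAt (fun w => g h (w + k) - g h w)
        ((fderiv ℂ f (w + k + h) - fderiv ℂ f (w + k)) - (fderiv ℂ f (w + h) - fderiv ℂ f w)) w := by
      intro w hw
      have h₁ := (hg' h (w + k) hh' (hmem' w hw)).comp w ((hasFDerivAt_id w).add_const k)
      rw [ContinuousLinearMap.comp_id] at h₁
      exact h₁.sub (hg' h w hh' (ball_subset_ball (by linarith) hw))
    have hGb : ∀ w ∈ ball z (r / 4), ‖g h (w + k) - g h w‖ ≤
        8 * (8 * C / r * ‖h‖) / (r / 2) * ‖k‖ := fun w hw =>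
      norm_add_sub_le_of_norm_le_on_ball hr2 (hgd h hh') (hgb h hh') (by linarith)
        (ball_subset_ball (by linarith) hw)
    have h₂ := norm_fderiv_le_of_norm_le_on_ball hr4
      (fun w hw => (hG w hw).differentiableAt.differentiableWithinAt) hGb
    rw [(hG z (hz2 _ hr4)).fderiv] at h₂
    have h₃ : q (h + k) - q h - q k = (fderiv ℂ f (z + k + h) - fderiv ℂ f (z + k)) -
        (fderiv ℂ f (z + h) - fderiv ℂ f z) := by
      simp only [hqdef]
      rw [show z + (h + k) = z + k + h by abel]
      abel
    rw [h₃]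
    refine h₂.trans (le_of_eq ?_)
    field_simp
    ring
  set K : ℝ := max (32 * C / r ^ 2) (1024 * C / r ^ 3)
  obtain ⟨B, hB⟩ := exists_hasFDerivAt_of_approx_additive (q := q) (δ := r / 8) (by positivity)
    (fun h hh => (hq h hh).trans (mul_le_mul_of_nonneg_right (le_max_left _ _) (norm_nonneg _)))
    (fun h k hh hk => (hadd h k hh hk).trans (mul_le_mul_of_nonneg_right
      (mul_le_mul_of_nonneg_right (le_max_right _ _) (norm_nonneg _)) (norm_nonneg _)))
  have hB' : HasFDerivAt (fderiv ℂ f) B z := by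
    have h₁ : HasFDerivAt (fun w => q (w - z) + fderiv ℂ f z) B z := by
      have h₂ : HasFDerivAt q B (z - z) := by rwa [sub_self]
      exact ((HasFDerivAt.comp (f := fun w => w - z) z h₂
        ((hasFDerivAt_id z).sub_const z)).congr_fderiv
        (ContinuousLinearMap.comp_id _)).add_const (fderiv ℂ f z)
    simpa [hqdef] using h₁
  -- At this stage `B` is only a real derivative, so symmetry is invoked for `f` as a real map.
  let R : (E →L[ℂ] F) →L[ℝ] (E →L[ℝ] F) := ContinuousLinearMap.restrictScalarsL ℂ E F ℝ ℝ
  have hsymm : ∀ v w, B v w = B w v := fun v w => by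
    refine second_derivative_symmetric_of_eventually_of_real (f := f) (x := z)
      (f' := fun y => R (fderiv ℂ f y)) (f'' := R ∘L B) ?_ (R.hasFDerivAt.comp z hB') v w
    filter_upwards [hU.mem_nhds hz] with y hy
    exact (hf.differentiableAt (hU.mem_nhds hy)).hasFDerivAt.restrictScalars ℝ
  let B' : E →L[ℂ] (E →L[ℂ] F) :=
    { toFun := B
      map_add' := B.map_add
      -- A complex scalar in the direction moves to the inner slot, where `B w` is complex linear,
      -- and back.
      map_smul' := fun c v => by
        ext w
        rw [hsymm, map_smul, hsymm]
        rfl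
      cont := B.cont }
  have h : HasFDerivAt (𝕜 := ℂ) (fderiv ℂ f) B' z := hasFDerivAt_of_restrictScalars ℝ hB' rfl
  exact h.differentiableAt

end HolomorphicDerivative

/-! ### Calculus of `A`-differentiable maps -/

/-- Completeness makes the range closed, so it contains the derivative's values, which are limits of
difference quotients lying in it; the isometry is then inverted on its range. It serves to descend
from all `ℂ`-multilinear maps to forms. -/
theorem LinearIsometry.differentiableAt_of_comp {E G H : Type*} [NormedAddCommGroup E]
    [NormedSpace ℂ E] [NormedAddCommGroup G] [NormedSpace ℂ G] [NormedAddCommGroup H]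
    [NormedSpace ℂ H] [CompleteSpace G] (T : G →ₗᵢ[ℂ] H) {F : E → G} {z : E}
    (h : DifferentiableAt ℂ (fun w => T (F w)) z) : DifferentiableAt ℂ F z := by
  obtain ⟨L, hL⟩ := h
  have hclosed : IsClosed (range T) := T.isometry.isClosedEmbedding.isClosed_range
  have hmem : ∀ v, L v ∈ LinearMap.range T.toLinearMap := fun v => by
    have hc : Filter.Tendsto (fun n : ℕ => ‖(n : ℂ)‖) Filter.atTop Filter.atTop := by
      simpa using tendsto_natCast_atTop_atTop (R := ℝ)
    refine hclosed.mem_of_tendsto (hL.lim v hc) (.of_forall fun n => ?_)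
    exact ⟨(n : ℂ) • (F (z + (n : ℂ)⁻¹ • v) - F z), by simp⟩
  let L' : E →L[ℂ] G := (T.equivRange.symm.toContinuousLinearEquiv :
    LinearMap.range T.toLinearMap →L[ℂ] G) ∘L L.codRestrict _ hmem
  have hL' : ∀ v, T (L' v) = L v := fun v =>
    congrArg Subtype.val (T.equivRange.apply_symm_apply ⟨L v, hmem v⟩)
  refine ⟨L', ?_⟩
  rw [hasFDerivAt_iff_isLittleO] at hL ⊢
  refine Asymptotics.IsLittleO.of_norm_left (hL.norm_left.congr_left fun w => ?_)
  rw [← hL', ← map_sub, ← map_sub, T.norm_map]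

section ADifferentiableAt

variable (A : Type u) {E F G : Type*} [NormedAddCommGroup E] [NormedSpace ℂ E] [SMul A E]
  [NormedAddCommGroup F] [NormedSpace ℂ F] [SMul A F]
  [NormedAddCommGroup G] [NormedSpace ℂ G] [SMul A G]

/-- `f` is Fréchet differentiable at `z`, with an `A`-linear derivative. -/
def ADifferentiableAt (f : E → F) (z : E) : Prop :=
  DifferentiableAt ℂ f z ∧ ∀ (a : A) (h : E), fderiv ℂ f z (a • h) = a • fderiv ℂ f z h

variable {A}

theorem HasFDerivAt.aDifferentiableAt {f : E → F} {z : E} {f' : E →L[ℂ] F}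
    (hf : HasFDerivAt f f' z) (h : ∀ (a : A) (v : E), f' (a • v) = a • f' v) :
    ADifferentiableAt A f z :=
  ⟨hf.differentiableAt, fun a v => by rw [hf.fderiv, h]⟩

namespace ADifferentiableAt

theorem continuousAt {f : E → F} {z : E} (hf : ADifferentiableAt A f z) : ContinuousAt f z :=
  hf.1.continuousAt

theorem congr_of_eventuallyEq {f g : E → F} {z : E} (hf : ADifferentiableAt A f z)
    (h : g =ᶠ[𝓝 z] f) : ADifferentiableAt A g z :=
  ⟨hf.1.congr_of_eventuallyEq h, fun a v => by rw [h.fderiv_eq, hf.2]⟩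

theorem comp {g : F → G} {f : E → F} (z : E) (hg : ADifferentiableAt A g (f z))
    (hf : ADifferentiableAt A f z) : ADifferentiableAt A (fun w => g (f w)) z :=
  HasFDerivAt.aDifferentiableAt (hg.1.hasFDerivAt.comp z hf.1.hasFDerivAt) fun a v => by
    simp only [ContinuousLinearMap.comp_apply, hf.2, hg.2]

theorem prodMk {f : E → F} {g : E → G} {z : E} (hf : ADifferentiableAt A f z)
    (hg : ADifferentiableAt A g z) : ADifferentiableAt A (fun w => (f w, g w)) z :=
  HasFDerivAt.aDifferentiableAt (hf.1.hasFDerivAt.prodMk hg.1.hasFDerivAt) fun a v =>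
    Prod.ext (hf.2 a v) (hg.2 a v)

theorem fst (z : E × F) : ADifferentiableAt A (Prod.fst : E × F → E) z :=
  HasFDerivAt.aDifferentiableAt hasFDerivAt_fst fun _ _ => rfl

theorem snd (z : E × F) : ADifferentiableAt A (Prod.snd : E × F → F) z :=
  HasFDerivAt.aDifferentiableAt hasFDerivAt_snd fun _ _ => rfl

theorem id (z : E) : ADifferentiableAt A (fun w : E => w) z :=
  HasFDerivAt.aDifferentiableAt (hasFDerivAt_id z) fun _ _ => rfl

end ADifferentiableAt

end ADifferentiableAt

section ADifferentiableAt

variable {A : Type u} [NormedCommRing A]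
  {E F : Type*} [NormedAddCommGroup E] [NormedSpace ℂ E] [Module A E]
  [NormedAddCommGroup F] [NormedSpace ℂ F] [Module A F]

namespace ADifferentiableAt

theorem const (c : F) (z : E) : ADifferentiableAt A (fun _ : E => c) z :=
  HasFDerivAt.aDifferentiableAt (hasFDerivAt_const c z) fun _ _ => by simp

theorem add {f g : E → F} {z : E} (hf : ADifferentiableAt A f z) (hg : ADifferentiableAt A g z) :
    ADifferentiableAt A (fun w => f w + g w) z :=
  HasFDerivAt.aDifferentiableAt (hf.1.hasFDerivAt.add hg.1.hasFDerivAt) fun a v => by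
    simp [hf.2, hg.2]

variable [NormedAlgebra ℂ A]

/-- Leibniz rule; commutativity of `A` moves the scalar past `f z`. -/
theorem smul [IsScalarTower ℂ A F] [IsBoundedSMul A F] {f : E → A} {g : E → F} {z : E}
    (hf : ADifferentiableAt A f z)
    (hg : ADifferentiableAt A g z) : ADifferentiableAt A (fun w => f w • g w) z :=
  HasFDerivAt.aDifferentiableAt (hf.1.hasFDerivAt.smul hg.1.hasFDerivAt) fun a v => by
    simp [hf.2, hg.2, smul_smul, mul_comm]

/-- The derivative of an `A`-differentiable map is, applied to a fixed vector, again
`A`-differentiable: its derivative is `A`-linear by the symmetry of the second derivative. -/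
theorem fderiv_apply [CompleteSpace F] [ContinuousConstSMul A F] [IsScalarTower ℂ A F]
    {f : E → F} {U : Set E} (hU : IsOpen U)
    (hf : ∀ z ∈ U, ADifferentiableAt A f z) {z : E} (hz : z ∈ U) (v : E) :
    ADifferentiableAt A (fun w => fderiv ℂ f w v) z := by
  have hd : DifferentiableAt ℂ (fderiv ℂ f) z :=
    DifferentiableOn.differentiableAt_fderiv
      (fun w hw => (hf w hw).1.differentiableWithinAt) hU hz
  have hv : ∀ v, HasFDerivAt (fun w => fderiv ℂ f w v)
      ((ContinuousLinearMap.apply ℂ F v).comp (fderiv ℂ (fderiv ℂ f) z)) z := fun v =>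
    (ContinuousLinearMap.apply ℂ F v).hasFDerivAt.comp z hd.hasFDerivAt
  have hsymm : ∀ x y, fderiv ℂ (fderiv ℂ f) z x y = fderiv ℂ (fderiv ℂ f) z y x :=
    second_derivative_symmetric_of_eventually (f := f) (f' := fderiv ℂ f) (by
      filter_upwards [hU.mem_nhds hz] with w hw using (hf w hw).1.hasFDerivAt) hd.hasFDerivAt
  have : SMulCommClass ℂ A F := IsScalarTower.to_smulCommClass
  -- Differentiate the identity `Df_w(ay) = a Df_w(y)` in `w`.
  have hlin : ∀ (a : A) (x y : E),
      fderiv ℂ (fderiv ℂ f) z x (a • y) = a • fderiv ℂ (fderiv ℂ f) z x y := by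
    intro a x y
    have h₁ : (fun w => fderiv ℂ f w (a • y)) =ᶠ[𝓝 z] fun w => a • fderiv ℂ f w y := by
      filter_upwards [hU.mem_nhds hz] with w hw using (hf w hw).2 a y
    have h₂ := ((hv (a • y)).congr_of_eventuallyEq h₁.symm).unique ((hv y).const_smul a)
    exact congrArg (fun L : E →L[ℂ] F => L x) h₂
  refine HasFDerivAt.aDifferentiableAt (hv v) fun a x => ?_
  change fderiv ℂ (fderiv ℂ f) z (a • x) v = a • fderiv ℂ (fderiv ℂ f) z x v
  rw [hsymm, hlin, hsymm]

end ADifferentiableAt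

/-! ### Forms pulled back along a varying linear map -/

namespace AltForm

variable [NormedAlgebra ℂ A] {X : BanachMod.{u, w} A} {Y : BanachMod.{u, w₁} A} {k : ℕ}

/-- `toComplex` as a linear isometry. -/
def toComplexₗᵢ (X : BanachMod.{u, w} A) (k : ℕ) :
    AltForm A X k →ₗᵢ[ℂ] ContinuousMultilinearMap ℂ (fun _ : Fin k => (X : Type w)) A where
  toFun := toComplex X k
  map_add' := (toComplex X k).map_add
  map_smul' c f := by
    ext x
    change algebraMap ℂ A c * toComplex X k f x = c • toComplex X k f x
    rw [Algebra.smul_def]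
  norm_map' _ := rfl

/-- By the Leibniz rule the derivative has a term differentiating `ω` and `k` terms each
differentiating one copy of `D`. In the first, `a` comes out by `hω`; in the others it comes out of
the derivative of `D` by `hDv`, then out of a slot of the `A`-multilinear form `ω z`. -/
theorem aDifferentiableAt_of_eventually_eq [CompleteSpace A] {F : E → AltForm A X k}
    {ω : E → AltForm A Y k} {D : E → (X →L[ℂ] Y)} {z : E} (hω : ADifferentiableAt A ω z)
    (hD : DifferentiableAt ℂ D z) (hDv : ∀ v, ADifferentiableAt A (fun w => D w v) z)
    (hF : ∀ᶠ w in 𝓝 z, ∀ x : Fin k → X, F w x = ω w (fun i => D w (x i))) :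
    ADifferentiableAt A F z := by
  have hω' : HasFDerivAt (fun w => toComplexₗᵢ Y k (ω w))
      ((toComplexₗᵢ Y k).toContinuousLinearMap ∘L fderiv ℂ ω z) z :=
    (toComplexₗᵢ Y k).toContinuousLinearMap.hasFDerivAt.comp z hω.1.hasFDerivAt
  have h := (hω'.continuousMultilinearMapCompContinuousLinearMap
    (g := fun _ => D) fun _ => hD.hasFDerivAt).congr_of_eventuallyEq
    (f₁ := fun w => toComplexₗᵢ X k (F w)) (by
      filter_upwards [hF] with w hw
      ext x
      exact hw x)
  have hd : DifferentiableAt ℂ F z :=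
    (toComplexₗᵢ X k).differentiableAt_of_comp h.differentiableAt
  -- Uniqueness of derivatives identifies the derivative of `F` with the Leibniz formula computed
  -- among `ℂ`-multilinear maps.
  have hT := h.unique ((toComplexₗᵢ X k).toContinuousLinearMap.hasFDerivAt.comp z hd.hasFDerivAt)
  have hDa : ∀ (a : A) (v : E) (x : X), fderiv ℂ D z (a • v) x = a • fderiv ℂ D z v x := by
    intro a v x
    have h₁ : HasFDerivAt (fun w => D w x)
        ((ContinuousLinearMap.apply ℂ (Y : Type w₁) x).comp (fderiv ℂ D z)) z :=
      (ContinuousLinearMap.apply ℂ (Y : Type w₁) x).hasFDerivAt.comp z hD.hasFDerivAt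
    have h₂ := (hDv x).2 a v
    rw [h₁.fderiv] at h₂
    exact h₂
  have key : ∀ (v : E) (x : Fin k → X), fderiv ℂ F z v x =
      fderiv ℂ ω z v (fun i => D z (x i)) +
        ∑ i, ω z (Function.update (fun j => D z (x j)) i (fderiv ℂ D z v (x i))) := by
    intro v x
    have h₁ := congrArg (fun L => (L v : ContinuousMultilinearMap ℂ _ A) x) hT
    refine h₁.symm.trans ?_
    simp only [add_apply, ContinuousLinearMap.comp_apply,
      ContinuousMultilinearMap.fderivCompContinuousLinearMap_apply]
    refine congrArg₂ (· + ·) rfl (Finset.sum_congr rfl fun i _ => ?_)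
    refine congrArg (ω z) (funext fun j => ?_)
    rcases eq_or_ne j i with rfl | hj
    · simp
    · simp [hj]
  refine ⟨hd, fun a v => toComplex_injective X k ?_⟩
  ext x
  change fderiv ℂ F z (a • v) x = a * fderiv ℂ F z v x
  rw [key, key, hω.2, mul_add, Finset.mul_sum]
  refine congrArg₂ (· + ·) rfl (Finset.sum_congr rfl fun i _ => ?_)
  rw [hDa]
  exact (ω z).toMultilinear.map_update_smul _ i a _

end AltForm

end ADifferentiableAt

/-! ### Coordinate expressions of holomorphic maps -/

section Coordinates

variable {A : Type u} [NormedCommRing A] [NormedAlgebra ℂ A]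
  {M : Type v} [TopologicalSpace M] {ι : Type v₁} {S : ι → AChart.{u, v, w} A M}

namespace IsAManifold

theorem continuousAt_symm (hS : IsAManifold S) {i : ι} {p : M} (hi : p ∈ (S i).source) :
    ContinuousAt (S i).symm (S i p) :=
  (hS.homeo i).continuousOn_symm.continuousAt
    ((hS.homeo i).isOpen_target.mem_nhds ((S i).toPartialEquiv.map_source hi))

theorem eventually_symm (hS : IsAManifold S) {i : ι} {p : M} (hi : p ∈ (S i).source)
    {P : M → Prop} (h : ∀ᶠ q in 𝓝 p, P q) : ∀ᶠ z in 𝓝 (S i p), P ((S i).symm z) := by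
  have hc := hS.continuousAt_symm hi
  have hp : (S i).symm (S i p) = p := (S i).toPartialEquiv.left_inv hi
  rw [ContinuousAt, hp] at hc
  exact hc.eventually h

theorem eventually_mem_source (hS : IsAManifold S) {i : ι} {p : M} (hi : p ∈ (S i).source) :
    ∀ᶠ q in 𝓝 p, q ∈ (S i).source :=
  (hS.homeo i).isOpen_source.mem_nhds hi

theorem eventually_mem_target (hS : IsAManifold S) {i : ι} {p : M} (hi : p ∈ (S i).source) :
    ∀ᶠ z in 𝓝 (S i p), z ∈ (S i).target :=
  (hS.homeo i).isOpen_target.mem_nhds ((S i).toPartialEquiv.map_source hi)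

theorem continuousAt (hS : IsAManifold S) {i : ι} {p : M} (hi : p ∈ (S i).source) :
    ContinuousAt (S i) p :=
  (hS.homeo i).continuousOn.continuousAt ((hS.homeo i).isOpen_source.mem_nhds hi)

theorem aDifferentiableAt_trans (hS : IsAManifold S) {i j : ι} {p : M} (hi : p ∈ (S i).source)
    (hj : p ∈ (S j).source) : ADifferentiableAt A (fun z => S j ((S i).symm z)) (S i p) :=
  hS.compat i j _ ⟨p, ⟨hi, hj⟩, rfl⟩

theorem aDifferentiableAt_trans_snd (hS : IsAManifold S) {F : Type*} [NormedAddCommGroup F]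
    [NormedSpace ℂ F] [Module A F] {i j : ι} {p : M} (hi : p ∈ (S i).source)
    (hj : p ∈ (S j).source) (f : F) :
    ADifferentiableAt A (fun z : F × (S i).Model => S j ((S i).symm z.2)) (f, S i p) :=
  ADifferentiableAt.comp (f := Prod.snd) (f, S i p) (hS.aDifferentiableAt_trans hi hj)
    (ADifferentiableAt.snd _)

theorem isOpen_image_inter (hS : IsAManifold S) (i j : ι) :
    IsOpen (S i '' ((S i).source ∩ (S j).source)) := by
  rw [(S i).toPartialEquiv.image_source_inter_eq']
  exact (hS.homeo i).continuousOn_symm.isOpen_inter_preimage (hS.homeo i).isOpen_target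
    (hS.homeo j).isOpen_source

end IsAManifold

namespace AHolomorphic

variable {N : Type v₂} [TopologicalSpace N] {κ : Type*} {T : κ → AChart.{u, v₂, w₂} A N}
  {U : Set M} {f : U → N} {F : M → N}

/-- The extension `F` of `f` to all of `M` supplies a coordinate expression free of subtypes; its
values off `U` are arbitrary. -/
theorem of_aDifferentiableAt (hc : Continuous f) (hF : ∀ p : U, F p = f p)
    (h : ∀ i j p, p ∈ U → p ∈ (S i).source → F p ∈ (T j).source →
      ADifferentiableAt A (fun z => T j (F ((S i).symm z))) (S i p)) :
    AHolomorphic S T f := by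
  refine ⟨hc, fun i j => ⟨fun z => T j (F ((S i).symm z)), fun p hp _ => ?_, ?_⟩⟩
  · have : (S i).symm (S i p) = p := (S i).toPartialEquiv.left_inv hp
    dsimp only
    rw [this, hF]
  · rintro _ ⟨p, hp, hfp, rfl⟩
    exact h i j p p.2 hp (by rwa [hF])

/-- Since `U` and the target chart's domain are open and `f` is continuous, the `g` of the
definition agrees with the expression of `F` near `S i p`. -/
theorem aDifferentiableAt (hS : IsAManifold S) (hT : ∀ j, IsOpen (T j).source) (hU : IsOpen U)
    (hf : AHolomorphic S T f) (hF : ∀ p : U, F p = f p) {i : ι} {j : κ} {p : M} (hp : p ∈ U)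
    (hi : p ∈ (S i).source) (hj : F p ∈ (T j).source) :
    ADifferentiableAt A (fun z => T j (F ((S i).symm z))) (S i p) := by
  obtain ⟨g, hg, hgd⟩ := hf.2 i j
  have hFc : ContinuousAt F p := by
    have h₁ : ContinuousOn F U := by
      rw [continuousOn_iff_continuous_domRestrict]
      exact hf.1.congr fun q => (hF q).symm
    exact h₁.continuousAt (hU.mem_nhds hp)
  refine ADifferentiableAt.congr_of_eventuallyEq
    (hgd (S i p) ⟨⟨p, hp⟩, hi, by rwa [← hF], rfl⟩) ?_
  filter_upwards [hS.eventually_mem_target hi, hS.eventually_symm hi (hU.mem_nhds hp),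
    hS.eventually_symm hi (hFc.eventually ((hT j).mem_nhds hj))] with z hz hzU hzj
  have hr : S i ((S i).symm z) = z := (S i).toPartialEquiv.right_inv hz
  have := hg ⟨(S i).symm z, hzU⟩ ((S i).toPartialEquiv.map_target hz) (by rwa [← hF])
  rw [← hF] at this
  simp only [hr] at this
  exact this.symm

end AHolomorphic

end Coordinates

/-! ### The charts of the cotangent exterior bundle -/

namespace CotangentBundle

variable {A : Type u} [NormedCommRing A] [NormedAlgebra ℂ A]
  {M : Type v} [TopologicalSpace M] {ι : Type v₁} {S : ι → AChart.{u, v, w} A M}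
  {hS : IsAManifold S} {k : ℕ}

theorem fiberCoord_apply {i : ι} {ω : CotangentBundle hS k} (hi : ω.proj ∈ (S i).source)
    (x : Fin k → (S i).Model) :
    fiberCoord hS k i ω x = ω.form (fun l => (TangentSp.coordL hS hi).symm (x l)) := by
  simp only [fiberCoord, dif_pos hi]
  rfl

theorem fiberCoord_apply_transD {i j : ι} {ω : CotangentBundle hS k}
    (hi : ω.proj ∈ (S i).source) (hj : ω.proj ∈ (S j).source) (x : Fin k → (S j).Model) :
    fiberCoord hS k j ω x = fiberCoord hS k i ω (fun l => transD S ω.proj j i (x l)) := by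
  rw [fiberCoord_apply hi, fiberCoord_apply hj]
  refine congrArg ω.form (funext fun l => ?_)
  exact ((TangentSp.coord hS hi).symm_apply_apply ((TangentSp.coord hS hj).symm (x l))).symm

theorem fiberCoord_injOn {i : ι} {p : M} (hi : p ∈ (S i).source) {f g : CotangentSp hS k p}
    (h : fiberCoord hS k i ⟨p, f⟩ = fiberCoord hS k i ⟨p, g⟩) : f = g := by
  have hf := ofFiberCoord_fiberCoord hS k i ⟨p, f⟩ hi
  have hg := ofFiberCoord_fiberCoord hS k i ⟨p, g⟩ hi
  rw [h, hg] at hf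
  cases hf
  rfl

theorem fiberCoord_zero (i : ι) (p : M) : fiberCoord hS k i ⟨p, 0⟩ = 0 := by
  by_cases hi : p ∈ (S i).source
  · refine Subtype.ext (ContinuousMultilinearMap.ext fun x => ?_)
    exact fiberCoord_apply (ω := ⟨p, 0⟩) hi x
  -- Off the chart domain `fiberCoord` is `0` by default, so the algebraic identities need no
  -- hypothesis on `p`.
  · exact dif_neg hi

theorem fiberCoord_add (i : ι) (p : M) (f g : CotangentSp hS k p) :
    fiberCoord hS k i ⟨p, f + g⟩ = fiberCoord hS k i ⟨p, f⟩ + fiberCoord hS k i ⟨p, g⟩ := by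
  by_cases hi : p ∈ (S i).source
  · refine Subtype.ext (ContinuousMultilinearMap.ext fun x => ?_)
    refine (fiberCoord_apply (ω := ⟨p, f + g⟩) hi x).trans (congrArg₂ (· + ·)
      (fiberCoord_apply (ω := ⟨p, f⟩) hi x) (fiberCoord_apply (ω := ⟨p, g⟩) hi x)).symm
  · simp [fiberCoord, hi]

theorem fiberCoord_smul (i : ι) (p : M) (a : A) (f : CotangentSp hS k p) :
    fiberCoord hS k i ⟨p, a • f⟩ = a • fiberCoord hS k i ⟨p, f⟩ := by
  by_cases hi : p ∈ (S i).source
  · refine Subtype.ext (ContinuousMultilinearMap.ext fun x => ?_)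
    exact (fiberCoord_apply (ω := ⟨p, a • f⟩) hi x).trans (congrArg (a * ·)
      (fiberCoord_apply (ω := ⟨p, f⟩) hi x)).symm
  · simp [fiberCoord, hi]

variable [CompleteSpace A]

/-- Change of the chart in which a family of forms is seen to be `A`-differentiable. -/
theorem aDifferentiableAt_fiberCoord {E : Type*} [NormedAddCommGroup E] [NormedSpace ℂ E]
    [Module A E] {ω : E → CotangentBundle hS k} {z : E} {i j : ι}
    (hω : ADifferentiableAt A (fun w => fiberCoord hS k i (ω w)) z)
    (hp : ADifferentiableAt A (fun w => S i (ω w).proj) z)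
    (hi : ∀ᶠ w in 𝓝 z, (ω w).proj ∈ (S i).source)
    (hj : ∀ᶠ w in 𝓝 z, (ω w).proj ∈ (S j).source) :
    ADifferentiableAt A (fun w => fiberCoord hS k j (ω w)) z := by
  have hiz := hi.self_of_nhds
  have hjz := hj.self_of_nhds
  have hq : ADifferentiableAt A (fun w => S j (ω w).proj) z := by
    refine ((hS.aDifferentiableAt_trans hiz hjz).comp z hp).congr_of_eventuallyEq ?_
    filter_upwards [hi] with w hw
    exact congrArg (S j) ((S i).toPartialEquiv.left_inv hw).symm
  have hopen := hS.isOpen_image_inter j i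
  have hmem : S j (ω z).proj ∈ S j '' ((S j).source ∩ (S i).source) := ⟨_, ⟨hjz, hiz⟩, rfl⟩
  -- Near `z` the `j`-coordinate is the `i`-coordinate pulled back along the derivative of the
  -- transformation from `j` to `i`, taken at the moving foot point.
  refine AltForm.aDifferentiableAt_of_eventually_eq
    (D := fun w => transD S (ω w).proj j i) hω ?_ (fun v => ?_) ?_
  · exact (DifferentiableOn.differentiableAt_fderiv
      (fun y hy => (hS.compat j i y hy).1.differentiableWithinAt) hopen hmem).comp z hq.1
  · exact (ADifferentiableAt.fderiv_apply hopen (hS.compat j i) hmem v).comp z hq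
  · filter_upwards [hi, hj] with w hw hw' x
    exact fiberCoord_apply_transD hw hw' x

/-- The form is written in chart `i`, read in chart `j`, and its foot point is given in chart `l`.
Chart changes have `l = i`; the inverse of a trivialization needs three independent charts. -/
theorem aDifferentiableAt_fiberCoord_ofFiberCoord {i j l : ι} {p : M} (hi : p ∈ (S i).source)
    (hj : p ∈ (S j).source) (hl : p ∈ (S l).source) (f : AltForm A (S i).Model k) :
    ADifferentiableAt A (fun z : AltForm A (S i).Model k × (S l).Model =>
      fiberCoord hS k j (ofFiberCoord hS k i ((S l).symm z.2) z.1)) (f, S l p) := by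
  have hev : ∀ m : ι, p ∈ (S m).source →
      ∀ᶠ z in 𝓝 (f, S l p), (S l).symm z.2 ∈ (S m).source := fun m hm =>
    (continuous_snd.tendsto (f, S l p)).eventually
      (p := fun y : (S l).Model => (S l).symm y ∈ (S m).source)
      (hS.eventually_symm hl (hS.eventually_mem_source hm))
  refine aDifferentiableAt_fiberCoord (i := i) ?_ ?_ (hev i hi) (hev j hj)
  · refine (ADifferentiableAt.fst _).congr_of_eventuallyEq ?_
    filter_upwards [hev i hi] with z hz
    exact fiberCoord_ofFiberCoord hS k i _ hz _
  · exact hS.aDifferentiableAt_trans_snd hl hi f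

end CotangentBundle

/-! ### The cotangent exterior bundle as a manifold and as a vector bundle -/

namespace CotangentBundle

variable {A : Type u} [NormedCommRing A] [NormedAlgebra ℂ A]
  {M : Type v} [TopologicalSpace M] {ι : Type v₁} {S : ι → AChart.{u, v, w} A M}
  (hS : IsAManifold S) (k : ℕ)

theorem isOpen_openBase {i : ι} {G : Set (AltForm A (S i).Model k)} {V : Set M} (hG : IsOpen G)
    (hV : IsOpen V) (hVi : V ⊆ (S i).source) :
    IsOpen {ω : CotangentBundle hS k | fiberCoord hS k i ω ∈ G ∧ ω.proj ∈ V} :=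
  isOpen_generateFrom_of_mem ⟨i, G, V, hG, hV, hVi, rfl⟩

theorem continuous_proj : Continuous (proj : CotangentBundle hS k → M) := by
  refine continuous_def.2 fun V hV => isOpen_iff_forall_mem_open.2 fun ω hω => ?_
  obtain ⟨i, hi⟩ := hS.cover ω.proj
  exact ⟨_, fun η hη => hη.2.1, isOpen_openBase hS k (i := i) isOpen_univ
    (hV.inter (hS.homeo i).isOpen_source) inter_subset_right, mem_univ _, hω, hi⟩

theorem continuousOn_fiberCoord (i : ι) :
    ContinuousOn (fiberCoord hS k i) {ω | ω.proj ∈ (S i).source} := by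
  refine (continuousOn_open_iff ?_).2 fun G hG => ?_
  · exact (hS.homeo i).isOpen_source.preimage (continuous_proj hS k)
  · have := isOpen_openBase hS k hG (hS.homeo i).isOpen_source Subset.rfl
    rwa [ofPred_and, inter_comm] at this

theorem t2Space : T2Space (CotangentBundle hS k) := by
  have := hS.t2
  refine ⟨fun ω η hne => ?_⟩
  rcases ne_or_eq ω.proj η.proj with h | h
  · exact separated_by_continuous (continuous_proj hS k) h
  obtain ⟨p, f⟩ := ω
  obtain ⟨q, g⟩ := η
  obtain rfl : p = q := h
  obtain ⟨i, hi⟩ := hS.cover p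
  have hfg : fiberCoord hS k i ⟨p, f⟩ ≠ fiberCoord hS k i ⟨p, g⟩ := fun h =>
    hne (congrArg _ (fiberCoord_injOn hi h))
  obtain ⟨G, H, hG, hH, hf, hg, hGH⟩ := t2_separation hfg
  refine ⟨_, _, isOpen_openBase hS k hG (hS.homeo i).isOpen_source Subset.rfl,
    isOpen_openBase hS k hH (hS.homeo i).isOpen_source Subset.rfl, ⟨hf, hi⟩, ⟨hg, hi⟩, ?_⟩
  exact disjoint_left.2 fun ω h₁ h₂ => disjoint_left.1 hGH h₁.1 h₂.1

/-- The linear map between the forms on two coordinate modules at `p`. -/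
def fiberTrans {p : M} {i j : ι} (hi : p ∈ (S i).source) (hj : p ∈ (S j).source) :
    AltForm A (S i).Model k →ₗ[A] AltForm A (S j).Model k where
  toFun := AltForm.pullback ((TangentSp.coordL hS hi : TangentSp hS p →L[A] (S i).Model).comp
    ((TangentSp.coordL hS hj).symm : (S j).Model →L[A] TangentSp hS p))
  map_add' _ _ := rfl
  map_smul' _ _ := rfl

/-- The local trivialization induced by a chart, as a bijection. -/
def trivEquiv (i : ι) : (proj ⁻¹' (S i).source : Set (CotangentBundle hS k)) ≃
    (univ ×ˢ (S i).source : Set (AltForm A (S i).Model k × M)) where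
  toFun ω := ⟨(fiberCoord hS k i ω, ω.1.proj), mem_univ _, ω.2⟩
  invFun z := ⟨ofFiberCoord hS k i z.1.2 z.1.1, z.2.2⟩
  left_inv ω := Subtype.ext (ofFiberCoord_fiberCoord hS k i ω.1 ω.2)
  right_inv z := Subtype.ext (Prod.ext (fiberCoord_ofFiberCoord hS k i _ z.2.2 _) rfl)

theorem continuous_trivEquiv (i : ι) : Continuous (trivEquiv hS k i) := by
  refine Continuous.subtype_mk (Continuous.prodMk ?_
    ((continuous_proj hS k).comp continuous_subtype_val)) _
  exact continuousOn_iff_continuous_domRestrict.1 (continuousOn_fiberCoord hS k i)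

variable [CompleteSpace A]

/-- It suffices to test the generating sets; the one from chart `j` is governed by the foot point
and by `fiberCoord` in chart `j`, which is differentiable and so continuous here. -/
theorem continuousAt_ofFiberCoord {i l : ι} {p : M} (hi : p ∈ (S i).source)
    (hl : p ∈ (S l).source) (f : AltForm A (S i).Model k) :
    ContinuousAt (fun z : AltForm A (S i).Model k × (S l).Model =>
      ofFiberCoord hS k i ((S l).symm z.2) z.1) (f, S l p) := by
  have hp : (S l).symm (S l p) = p := (S l).toPartialEquiv.left_inv hl
  refine tendsto_nhds_generateFrom_iff.2 ?_
  rintro _ ⟨j, G, V, hG, hV, hVj, rfl⟩ ⟨h₁, h₂⟩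
  have hpV : p ∈ V := by rw [← hp]; exact h₂
  have hc := (aDifferentiableAt_fiberCoord_ofFiberCoord (hS := hS) hi (hVj hpV) hl f).continuousAt
  have hV' : ∀ᶠ z : AltForm A (S i).Model k × (S l).Model in 𝓝 (f, S l p), (S l).symm z.2 ∈ V :=
    (continuous_snd.tendsto (f, S l p)).eventually
      (p := fun y : (S l).Model => (S l).symm y ∈ V) (hS.eventually_symm hl (hV.mem_nhds hpV))
  filter_upwards [hc.eventually (hG.mem_nhds h₁), hV'] with z hz hz' using ⟨hz, hz'⟩

theorem isOpenHomeo_chart (i : ι) : (chart hS k i).IsOpenHomeo where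
  isOpen_source := (hS.homeo i).isOpen_source.preimage (continuous_proj hS k)
  isOpen_target := (hS.homeo i).isOpen_target.preimage continuous_snd
  continuousOn := (continuousOn_fiberCoord hS k i).prodMk
    ((hS.homeo i).continuousOn.comp (continuous_proj hS k).continuousOn fun _ h => h)
  continuousOn_symm := by
    rintro ⟨f, y⟩ hy
    replace hy : y ∈ (S i).target := hy
    have hi := (S i).toPartialEquiv.map_target hy
    have := continuousAt_ofFiberCoord hS k hi hi f
    rw [(S i).toPartialEquiv.right_inv hy] at this
    exact this.continuousWithinAt

/-- An open `W` around `ω` pulls back under the inverse chart to a neighbourhood of the coordinates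
of `ω`, which contains a product; that product gives a member of the family inside `W`.
Intersections over different charts need no separate treatment. -/
theorem isTopologicalBasis_openBase : IsTopologicalBasis (openBase hS k) := by
  refine isTopologicalBasis_of_isOpen_of_nhds (fun W hW => isOpen_generateFrom_of_mem hW)
    fun ω W hω hW => ?_
  obtain ⟨i, hi⟩ := hS.cover ω.proj
  have hc := continuousAt_ofFiberCoord hS k hi hi (fiberCoord hS k i ω)
  have hω' : ofFiberCoord hS k i ((S i).symm (S i ω.proj)) (fiberCoord hS k i ω) = ω :=
    (chart hS k i).toPartialEquiv.left_inv hi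
  have hWn := hc.eventually (hW.mem_nhds (by
    dsimp only
    rwa [hω']))
  rw [nhds_prod_eq] at hWn
  obtain ⟨P, hP, Q, hQ, hPQ⟩ := Filter.eventually_prod_iff.1 hWn
  obtain ⟨G, hGP, hG, hGω⟩ := mem_nhds_iff.1 hP
  obtain ⟨V, hVQ, hV, hVω⟩ := mem_nhds_iff.1 (Filter.inter_mem
    ((hS.continuousAt hi).eventually hQ) (hS.eventually_mem_source hi))
  refine ⟨_, ⟨i, G, V, hG, hV, fun p hp => (hVQ hp).2, rfl⟩, ⟨hGω, hVω⟩, fun η hη => ?_⟩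
  have := hPQ (hGP hη.1) (hVQ hη.2).1
  have hη' : ofFiberCoord hS k i ((S i).symm (S i η.proj)) (fiberCoord hS k i η) = η :=
    (chart hS k i).toPartialEquiv.left_inv (hVQ hη.2).2
  rw [← hη']
  exact this

theorem isAManifold_chart : IsAManifold (chart hS k) where
  t2 := t2Space hS k
  homeo := isOpenHomeo_chart hS k
  cover ω := hS.cover ω.proj
  compat i j := by
    rintro _ ⟨ω, ⟨hi, hj⟩, rfl⟩
    exact (aDifferentiableAt_fiberCoord_ofFiberCoord (S := S) (p := ω.proj) hi hj hi _).prodMk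
      (hS.aDifferentiableAt_trans_snd hi hj _)

theorem continuous_trivEquiv_symm (i : ι) : Continuous (trivEquiv hS k i).symm := by
  refine Continuous.subtype_mk ?_ _
  refine (continuousOn_iff_continuous_domRestrict
    (f := fun z : AltForm A (S i).Model k × M => ofFiberCoord hS k i z.2 z.1)).1 ?_
  rintro ⟨f, p⟩ hp
  replace hp : p ∈ (S i).source := hp.2
  refine ContinuousAt.continuousWithinAt ?_
  have hc : ContinuousAt (fun z : AltForm A (S i).Model k × M => (z.1, S i z.2)) (f, p) :=
    continuousAt_fst.prodMk ((hS.continuousAt hp).comp (f := Prod.snd) (x := (f, p))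
      continuousAt_snd)
  refine (ContinuousAt.comp (f := fun z : AltForm A (S i).Model k × M => (z.1, S i z.2))
    (x := (f, p)) (continuousAt_ofFiberCoord hS k hp hp f) hc).congr ?_
  have hs : ∀ᶠ z : AltForm A (S i).Model k × M in 𝓝 (f, p), z.2 ∈ (S i).source :=
    (continuous_snd.tendsto (f, p)).eventually (hS.eventually_mem_source hp)
  filter_upwards [hs] with z hz
  exact congrArg (fun q => ofFiberCoord hS k i q z.1) ((S i).toPartialEquiv.left_inv hz)

theorem isAHolomorphicVectorBundle :
    IsAHolomorphicVectorBundle (chart hS k) S proj (localTriv hS k) where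
  total := isAManifold_chart hS k
  base := hS
  proj_holomorphic := by
    refine AHolomorphic.of_aDifferentiableAt (F := proj)
      ((continuous_proj hS k).comp continuous_subtype_val) (fun _ => rfl) fun i j ω _ hi hj => ?_
    exact hS.aDifferentiableAt_trans_snd hi hj (fiberCoord hS k i ω)
  proj_surjective p := ⟨⟨p, 0⟩, rfl⟩
  isOpen_base i := (hS.homeo i).isOpen_source
  cover := eq_univ_of_forall fun p => mem_iUnion.2 (hS.cover p)
  biholomorphic i := by
    refine ⟨trivEquiv hS k i, fun _ => rfl, ?_, ?_⟩
    · refine AHolomorphic.of_aDifferentiableAt (F := fun ω => (fiberCoord hS k i ω, ω.proj))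
        (continuous_subtype_val.comp (continuous_trivEquiv hS k i)) (fun _ => rfl)
        fun j l ω hω hj hl => ?_
      exact (aDifferentiableAt_fiberCoord_ofFiberCoord (S := S) (p := ω.proj) hj hω hj _).prodMk
        (hS.aDifferentiableAt_trans_snd hj hl.2 _)
    · refine AHolomorphic.of_aDifferentiableAt (F := fun z => ofFiberCoord hS k i z.2 z.1)
        (continuous_subtype_val.comp (continuous_trivEquiv_symm hS k i)) (fun _ => rfl)
        fun l j z hz hl hj => ?_
      exact (aDifferentiableAt_fiberCoord_ofFiberCoord hz.2 hj hl.2 z.1).prodMk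
        (hS.aDifferentiableAt_trans_snd hl.2 hj _)
  linear i j p hp := ⟨fiberTrans hS k hp.1 hp.2, by
    rintro ω rfl
    exact Subtype.ext (ContinuousMultilinearMap.ext (fiberCoord_apply_transD hp.1 hp.2))⟩

end CotangentBundle

/-! ### The sheaves of holomorphic functions and forms -/

section Sheaves

variable {A : Type u} [NormedCommRing A] [NormedAlgebra ℂ A] [CompleteSpace A]
  {M : Type v} [TopologicalSpace M] {ι : Type v₁} {S : ι → AChart.{u, v, w} A M}

open Classical in
/-- The extension by zero of a section over `U`. -/
def extendZero {F : M → Type*} [∀ p, Zero (F p)] {U : Opens M} (s : ∀ p : U, F p) (p : M) : F p :=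
  if h : p ∈ U then s ⟨p, h⟩ else 0

theorem extendZero_of_mem {F : M → Type*} [∀ p, Zero (F p)] {U : Opens M} (s : ∀ p : U, F p)
    {p : M} (h : p ∈ U) : extendZero s p = s ⟨p, h⟩ := dif_pos h

theorem mem_holomorphicFunctions_iff (hS : IsAManifold S) {U : Opens M} {f : U → A} :
    f ∈ holomorphicFunctions S U ↔ ∀ i, ∀ p ∈ U, p ∈ (S i).source →
      ADifferentiableAt A (fun z => extendZero (F := fun _ => A) f ((S i).symm z)) (S i p) := by
  have hF : ∀ p : (U : Set M), extendZero (F := fun _ => A) f p = f p := fun p =>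
    extendZero_of_mem _ p.2
  constructor
  · intro h i p hp hi
    exact AHolomorphic.aDifferentiableAt hS (fun _ => isOpen_univ) U.isOpen h hF (j := ()) hp hi
      (mem_univ _)
  · intro h
    refine AHolomorphic.of_aDifferentiableAt ?_ hF fun i _ p hp hi _ => h i p hp hi
    refine continuous_iff_continuousAt.2 fun p => ?_
    obtain ⟨i, hi⟩ := hS.cover p
    have h₁ : ContinuousAt (extendZero (F := fun _ => A) f) (p : M) := by
      refine (ContinuousAt.comp (h i p p.2 hi).continuousAt (hS.continuousAt hi)).congr ?_
      filter_upwards [hS.eventually_mem_source hi] with q hq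
      exact congrArg _ ((S i).toPartialEquiv.left_inv hq)
    exact (h₁.comp continuousAt_subtype_val).congr (.of_forall hF)

/-- Reading form and foot point in the same chart is enough: other fibre charts follow from
`aDifferentiableAt_fiberCoord`, and continuity is recovered by applying the continuous inverse
chart. -/
theorem mem_holomorphicForms_iff (hS : IsAManifold S) {k : ℕ} {U : Opens M}
    {s : ∀ p : U, CotangentSp hS k (p : M)} :
    s ∈ holomorphicForms hS k U ↔ ∀ i, ∀ p ∈ U, p ∈ (S i).source →
      ADifferentiableAt A (fun z => CotangentBundle.fiberCoord hS k i
        ⟨(S i).symm z, extendZero (F := CotangentSp hS k) s ((S i).symm z)⟩) (S i p) := by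
  have hF : ∀ p : (U : Set M), (⟨p, extendZero (F := CotangentSp hS k) s p⟩ :
      CotangentBundle hS k) = ⟨p, s p⟩ := fun p => congrArg _ (extendZero_of_mem _ p.2)
  constructor
  · intro h i p hp hi
    have h₁ := AHolomorphic.aDifferentiableAt hS
      (fun j => (CotangentBundle.isOpenHomeo_chart hS k j).isOpen_source) U.isOpen h
      (F := fun p => ⟨p, extendZero (F := CotangentSp hS k) s p⟩) hF (j := i) hp hi hi
    exact ADifferentiableAt.comp (g := Prod.fst) (S i p) (ADifferentiableAt.fst _) h₁
  · intro h
    refine AHolomorphic.of_aDifferentiableAt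
      (F := fun p => ⟨p, extendZero (F := CotangentSp hS k) s p⟩) ?_ hF fun i j p hp hi hj => ?_
    · refine continuous_iff_continuousAt.2 fun p => ?_
      obtain ⟨i, hi⟩ := hS.cover p
      have h₁ : ContinuousAt (fun q => (⟨q, extendZero (F := CotangentSp hS k) s q⟩ :
          CotangentBundle hS k)) (p : M) := by
        have hc := (ContinuousAt.comp (h i p p.2 hi).continuousAt (hS.continuousAt hi)).prodMk
          (hS.continuousAt hi)
        refine (ContinuousAt.comp (f := fun q => (CotangentBundle.fiberCoord hS k i
          ⟨(S i).symm (S i q), extendZero (F := CotangentSp hS k) s ((S i).symm (S i q))⟩, S i q))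
          (CotangentBundle.continuousAt_ofFiberCoord hS k hi hi _) hc).congr ?_
        filter_upwards [hS.eventually_mem_source hi] with q hq
        have hq' : (S i).symm (S i q) = q := (S i).toPartialEquiv.left_inv hq
        refine (congrArg (fun r => CotangentBundle.ofFiberCoord hS k i r
          (CotangentBundle.fiberCoord hS k i
            ⟨r, extendZero (F := CotangentSp hS k) s r⟩)) hq').trans ?_
        exact CotangentBundle.ofFiberCoord_fiberCoord hS k i
          ⟨q, extendZero (F := CotangentSp hS k) s q⟩ hq
      exact (h₁.comp continuousAt_subtype_val).congr (.of_forall hF)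
    · refine ADifferentiableAt.prodMk ?_ (hS.aDifferentiableAt_trans hi hj)
      exact CotangentBundle.aDifferentiableAt_fiberCoord (h i p hp hi)
        ((ADifferentiableAt.id _).congr_of_eventuallyEq (by
          filter_upwards [hS.eventually_mem_target hi] with z hz using
            (S i).toPartialEquiv.right_inv hz))
        (hS.eventually_symm hi (hS.eventually_mem_source hi))
        (hS.eventually_symm hi (hS.eventually_mem_source hj))

/-- A property of sections that is checked on germs defines a sheaf. -/
theorem isSheafOfSections_of_local {F : M → Type w₁} [∀ p, Zero (F p)]
    {P : ∀ U : Opens M, Set (∀ p : U, F p)} (Q : (∀ p, F p) → M → Prop)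
    (hQ : ∀ {s t : ∀ p, F p} {p : M}, (∀ᶠ q in 𝓝 p, s q = t q) → Q s p → Q t p)
    (hP : ∀ (U : Opens M) (s : ∀ p : U, F p), s ∈ P U ↔ ∀ p ∈ U, Q (extendZero s) p) :
    IsSheafOfSections P where
  restrict {U V} h s hs := (hP _ _).2 fun p hp => by
    refine hQ ?_ ((hP U s).1 hs p (h hp))
    filter_upwards [V.isOpen.mem_nhds hp] with q hq
    rw [extendZero_of_mem _ hq, extendZero_of_mem _ (h hq)]
  glue {κ} U s hs hcompat := by
    have hex : ∀ p : (⨆ a, U a : Opens M), ∃ a, (p : M) ∈ U a := fun p => Opens.mem_iSup.1 p.2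
    -- The glued section uses an arbitrary chosen index at each point; compatibility (`hval`) makes
    -- it agree near `p` with any `s a` defined there.
    choose c hc using hex
    have hval : ∀ (a : κ) (p : M) (ha : p ∈ U a),
        s (c ⟨p, le_iSup U a ha⟩) ⟨p, hc _⟩ = s a ⟨p, ha⟩ := fun a p ha => hcompat _ _ p _ ha
    refine ⟨fun p => s (c p) ⟨p, hc p⟩, ⟨(hP _ _).2 fun p hp => ?_, hval⟩, ?_⟩
    · obtain ⟨a, ha⟩ := Opens.mem_iSup.1 hp
      refine hQ ?_ ((hP _ _).1 (hs a) p ha)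
      filter_upwards [(U a).isOpen.mem_nhds ha] with q hq
      rw [extendZero_of_mem _ hq, extendZero_of_mem _ (le_iSup U a hq)]
      exact (hval a q hq).symm
    · rintro t ⟨-, ht⟩
      funext p
      exact ht (c p) p (hc p)

theorem isSheafOfModules_holomorphicForms (hS : IsAManifold S) (k : ℕ) :
    IsSheafOfModules (holomorphicFunctions S) (holomorphicForms hS k) where
  ring_sheaf := by
    refine isSheafOfSections_of_local (fun f p => ∀ i, p ∈ (S i).source →
      ADifferentiableAt A (fun z => f ((S i).symm z)) (S i p)) ?_ ?_
    · intro f g p hfg hf i hi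
      refine (hf i hi).congr_of_eventuallyEq ?_
      filter_upwards [hS.eventually_symm hi hfg] with z hz using hz.symm
    · intro U f
      rw [mem_holomorphicFunctions_iff hS]
      exact ⟨fun h p hp i hi => h i p hp hi, fun h i p hp hi => h p hp i hi⟩
  const_mem U c := by
    refine (mem_holomorphicFunctions_iff hS).2 fun i p hp hi =>
      (ADifferentiableAt.const c _).congr_of_eventuallyEq ?_
    filter_upwards [hS.eventually_symm hi (U.isOpen.mem_nhds hp)] with z hz
    exact extendZero_of_mem _ hz
  ring_add U f g hf hg := by
    rw [mem_holomorphicFunctions_iff hS] at hf hg ⊢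
    refine fun i p hp hi => ((hf i p hp hi).add (hg i p hp hi)).congr_of_eventuallyEq ?_
    filter_upwards [hS.eventually_symm hi (U.isOpen.mem_nhds hp)] with z hz
    rw [extendZero_of_mem _ hz, extendZero_of_mem _ hz, extendZero_of_mem _ hz]
  ring_mul U f g hf hg := by
    rw [mem_holomorphicFunctions_iff hS] at hf hg ⊢
    refine fun i p hp hi => ((hf i p hp hi).smul (hg i p hp hi)).congr_of_eventuallyEq ?_
    filter_upwards [hS.eventually_symm hi (U.isOpen.mem_nhds hp)] with z hz
    rw [extendZero_of_mem _ hz, extendZero_of_mem _ hz, extendZero_of_mem _ hz, smul_eq_mul]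
  sheaf := by
    refine isSheafOfSections_of_local (fun s p => ∀ i, p ∈ (S i).source →
      ADifferentiableAt A (fun z => CotangentBundle.fiberCoord hS k i
        ⟨(S i).symm z, s ((S i).symm z)⟩) (S i p)) ?_ ?_
    · intro s t p hst hs i hi
      refine (hs i hi).congr_of_eventuallyEq ?_
      filter_upwards [hS.eventually_symm hi hst] with z hz
      rw [hz]
    · intro U s
      rw [mem_holomorphicForms_iff hS]
      exact ⟨fun h p hp i hi => h i p hp hi, fun h i p hp hi => h p hp i hi⟩
  zero_mem U := by
    refine (mem_holomorphicForms_iff hS).2 fun i p hp hi =>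
      (ADifferentiableAt.const 0 _).congr_of_eventuallyEq ?_
    filter_upwards [hS.eventually_symm hi (U.isOpen.mem_nhds hp)] with z hz
    rw [extendZero_of_mem _ hz, CotangentBundle.fiberCoord_zero]
  add_mem U s t hs ht := by
    rw [mem_holomorphicForms_iff hS] at hs ht ⊢
    refine fun i p hp hi => ((hs i p hp hi).add (ht i p hp hi)).congr_of_eventuallyEq ?_
    filter_upwards [hS.eventually_symm hi (U.isOpen.mem_nhds hp)] with z hz
    rw [extendZero_of_mem _ hz, extendZero_of_mem _ hz, extendZero_of_mem _ hz,
      CotangentBundle.fiberCoord_add]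
  smul_mem U f s hf hs := by
    rw [mem_holomorphicFunctions_iff hS] at hf
    rw [mem_holomorphicForms_iff hS] at hs ⊢
    refine fun i p hp hi => ((hf i p hp hi).smul (hs i p hp hi)).congr_of_eventuallyEq ?_
    filter_upwards [hS.eventually_symm hi (U.isOpen.mem_nhds hp)] with z hz
    rw [extendZero_of_mem _ hz, extendZero_of_mem _ hz, extendZero_of_mem _ hz,
      CotangentBundle.fiberCoord_smul]

end Sheaves

end

theorem proposition38 {A : Type u} [NormedCommRing A] [NormedAlgebra ℂ A] [CompleteSpace A]
    {M : Type v} [TopologicalSpace M] {ι : Type v₁} (S : ι → AChart.{u, v, w} A M)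
    (hS : IsAManifold S) (k : ℕ) :
    IsTopologicalBasis (CotangentBundle.openBase hS k) ∧
    T2Space (CotangentBundle hS k) ∧
    IsAManifold (CotangentBundle.chart hS k) ∧
    IsAHolomorphicVectorBundle (CotangentBundle.chart hS k) S CotangentBundle.proj
      (CotangentBundle.localTriv hS k) ∧
    IsSheafOfModules (holomorphicFunctions S) (holomorphicForms hS k) :=
  ⟨CotangentBundle.isTopologicalBasis_openBase hS k, CotangentBundle.t2Space hS k,
    CotangentBundle.isAManifold_chart hS k, CotangentBundle.isAHolomorphicVectorBundle hS k,
    isSheafOfModules_holomorphicForms hS k⟩
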